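/- Let $\mathfrak K$ be a separable complex Hilbert space, $\mathfrak H=\mathfrak K\otimes L^2(0,\infty)$ (the square integrable $\mathfrak K$-valued functions on $(0,\infty)$), with inner products conjugate linear in the first entry. Let $\Lambda:\mathfrak B(\mathfrak K)\to\mathfrak B(\mathfrak H)$ be $(\Lambda(A)f)(x)=e^{-x}Af(x)$, write $\Lambda=\Lambda(I)$, and let $E(t,\infty)$ be the projection of $\mathfrak H$ onto the functions vanishing a.e. outside $(t,\infty)$. Put $A|_t=E(t,\infty)AE(t,\infty)$ for $t>0$ and $\mathfrak A(\mathfrak H)=(I-\Lambda)^{1/2}\mathfrak B(\mathfrak H)(I-\Lambda)^{1/2}$, which contains every $A|_t$, $t>0$. A boundary weight $\mu\in\mathfrak A(\mathfrak H)_*$ is a linear functional on $\mathfrak A(\mathfrak H)$ such that $A\mapsto\mu((I-\Lambda)^{1/2}A(I-\Lambda)^{1/2})$ is a normal bounded functional on $\mathfrak B(\mathfrak H)$; it is positive if it is nonnegative on positive elements, and $\mu\ge\nu$ means that $\mu-\nu$ is positive. For an operator $T\in\mathfrak B(\mathfrak H)$, $\mu(T)$ denotes $\lim_{t\to0+}\mu(T|_t)$.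 A boundary weight map is a linear map $\omega:\mathfrak B(\mathfrak K)_*\to\mathfrak A(\mathfrak H)_*$. Its truncations are $\omega|_t(\rho)(A)=\omega(\rho)(A|_t)$, $A\in\mathfrak B(\mathfrak H)$, and $\hat\Lambda:\mathfrak B(\mathfrak H)_*\to\mathfrak B(\mathfrak K)_*$ is $\hat\Lambda(\eta)(A)=\eta(\Lambda(A))$. The map $\omega$ is a $q$-weight map if it is completely positive, $\omega(\rho)(I-\Lambda)\le\rho(I)$ for all positive $\rho\in\mathfrak B(\mathfrak K)_*$, and for every $t>0$ the map $I+\hat\Lambda\omega|_t$ on $\mathfrak B(\mathfrak K)_*$ is invertible and $\hat\pi_t=\omega|_t(I+\hat\Lambda\omega|_t)^{-1}$ is a completely positive contraction from $\mathfrak B(\mathfrak K)_*$ to $\mathfrak B(\mathfrak H)_*$. Its range rank is the dimension of the range of $\breve\omega:\mathfrak A(\mathfrak H)\to\mathfrak B(\mathfrak K)$, $\rho(\breve\omega(T))=\omega(\rho)(T)$. Theorem. Let $e_1,e_2\in\mathfrak B(\mathfrak K)$ be positive operators such that, for real $x_1,x_2$, $$0\le x_1e_1+x_2e_2\le I\iff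 x_1,x_2\in[0,1].$$ Let $\mu_1,\mu_2\in\mathfrak A(\mathfrak H)_*$ be positive boundary weights and let $\omega(\rho)=\rho(e_1)\mu_1+\rho(e_2)\mu_2$ for $\rho\in\mathfrak B(\mathfrak K)_*$. For $t>0$ put $$h_1(t)=\frac{\mu_1(\Lambda(e_2)|_t)}{1+\mu_2(\Lambda(e_2)|_t)},\qquad h_2(t)=\frac{\mu_2(\Lambda(e_1)|_t)}{1+\mu_1(\Lambda(e_1)|_t)},\qquad \kappa_i=\sup_{t>0}h_i(t).$$ Then $\omega$ is a $q$-weight map if and only if the following conditions hold: (a) $\kappa_1,\kappa_2\in[0,1]$ (in particular both suprema are finite); (b) $\mu_1\ge\kappa_1\mu_2$ and $\mu_2\ge\kappa_2\mu_1$; (c) the values $x=\mu_1(I-\Lambda(e_1+e_2))$ and $y=\mu_2(I-\Lambda(e_1+e_2))$ exist and are finite, and $(x,y)$ lies in the (possibly degenerate) parallelogram $S_o$ with opposite vertices $(0,0)$ and $(1,1)$ and sides parallel to the lines $x=\kappa_1y$ and $y=\kappa_2x$. Here, for $\kappa_1,\kappa_2\in[0,1]$: if $\kappa_1=1$ or $\kappa_2=1$,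 then $S_o$ is the segment $0\le x=y\le1$; if $\kappa_1<1$ and $\kappa_2<1$, then $S_o$ is the set of points with $$0\le x-\kappa_1y\le1-\kappa_1\quad\text{and}\quad 0\le y-\kappa_2x\le1-\kappa_2.$$ Furthermore, if (a), (b), (c) hold, then $h_1$ and $h_2$ are non-increasing on $(0,\infty)$, $h_1(t)\to\kappa_1$ and $h_2(t)\to\kappa_2$ as $t\to0+$, and if $\kappa_1=1$ or $\kappa_2=1$ then $\mu_1=\mu_2$ and $\omega$ is a $q$-weight map of range rank one. -/

import Mathlib

open MeasureTheory Filter Topology Set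
open scoped ComplexOrder ENNReal

noncomputable section

namespace CPFlow

/-! ### Normal functionals on `B(E)` -/

section Predual

variable {E : Type*} [NormedAddCommGroup E] [InnerProductSpace ℂ E]

/-- The vector functional `A ↦ (f, A g)` on `B(E)` (conjugate linear in `f`). -/
def vecFun (f g : E) : (E →L[ℂ] E) →L[ℂ] ℂ :=
  (innerSL ℂ f).comp (ContinuousLinearMap.apply ℂ E g)

@[simp] lemma vecFun_apply (f g : E) (A : E →L[ℂ] E) : vecFun f g A = inner ℂ f (A g) := rfl

lemma norm_vecFun_le (f g : E) : ‖vecFun f g‖ ≤ ‖f‖ * ‖g‖ := by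
  refine ContinuousLinearMap.opNorm_le_bound _ (by positivity) fun A => ?_
  calc ‖inner ℂ f (A g)‖ ≤ ‖f‖ * ‖A g‖ := norm_inner_le_norm _ _
    _ ≤ ‖f‖ * (‖A‖ * ‖g‖) := by gcongr; exact A.le_opNorm g
    _ = ‖f‖ * ‖g‖ * ‖A‖ := by ring

lemma continuous_vecFun : Continuous fun p : E × E => vecFun p.1 p.2 := by
  have h : (fun p : E × E => vecFun p.1 p.2) = fun p =>
      ContinuousLinearMap.compL ℂ (E →L[ℂ] E) E ℂ (innerSL ℂ p.1)
        (ContinuousLinearMap.apply ℂ E p.2) := rfl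
  rw [h]
  exact ((ContinuousLinearMap.continuous _).comp
    ((innerSL ℂ (E := E)).continuous.comp continuous_fst)).clm_apply
    ((ContinuousLinearMap.continuous _).comp continuous_snd)

variable (E) in
/-- The predual `B(E)_*`: the space of normal (`σ`-weakly continuous) functionals on `B(E)`, i.e.
the norm closure, in the Banach dual of `B(E)`, of the linear span of the vector functionals. It
carries the norm of the dual. -/
def Predual : Submodule ℂ ((E →L[ℂ] E) →L[ℂ] ℂ) :=
  (Submodule.span ℂ (Set.range fun p : E × E => vecFun p.1 p.2)).topologicalClosure

lemma vecFun_mem (f g : E) : vecFun f g ∈ Predual E :=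
  Submodule.le_topologicalClosure _ (Submodule.subset_span ⟨(f, g), rfl⟩)

lemma isClosed_predual : IsClosed (Predual E : Set ((E →L[ℂ] E) →L[ℂ] ℂ)) :=
  Submodule.isClosed_topologicalClosure _

/-- To see that precomposition with a bounded map preserves normality, it suffices to look at vector
functionals. -/
lemma comp_mem_predual {F : Type*} [NormedAddCommGroup F] [InnerProductSpace ℂ F]
    (T : (F →L[ℂ] F) →L[ℂ] (E →L[ℂ] E))
    (hT : ∀ f g : E, (vecFun f g).comp T ∈ Predual F)
    {η : (E →L[ℂ] E) →L[ℂ] ℂ} (hη : η ∈ Predual E) : η.comp T ∈ Predual F := by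
  let Ψ : ((E →L[ℂ] E) →L[ℂ] ℂ) →L[ℂ] ((F →L[ℂ] F) →L[ℂ] ℂ) :=
    (ContinuousLinearMap.compL ℂ (F →L[ℂ] F) (E →L[ℂ] E) ℂ).flip T
  have h : Predual E ≤ (Predual F).comap (Ψ : _ →ₗ[ℂ] _) := by
    refine Submodule.topologicalClosure_minimal _ ?_ ?_
    · rw [Submodule.span_le]
      rintro _ ⟨p, rfl⟩
      exact hT p.1 p.2
    · exact isClosed_predual.preimage Ψ.continuous
  exact h hη

end Predual

/-- The positive square root of a positive operator. -/
def opSqrt {E : Type*} [NormedAddCommGroup E] [InnerProductSpace ℂ E] [CompleteSpace E]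
    (A : E →L[ℂ] E) : E →L[ℂ] E := CFC.sqrt A

lemma opSqrt_unique {E : Type*} [NormedAddCommGroup E] [InnerProductSpace ℂ E] [CompleteSpace E]
    {A B : E →L[ℂ] E} (h : B * B = A) (hB : 0 ≤ B) : opSqrt A = B :=
  CFC.sqrt_unique h hB

/-! ### The Hilbert space `𝔎 ⊗ L²(0,∞)`, multiplication operators, `Λ` and `E(t,∞)` -/

/-- Lebesgue measure on `(0,∞)`. -/
abbrev halfLine : Measure ℝ := volume.restrict (Ioi (0 : ℝ))

section Operators

variable (K : Type*) [NormedAddCommGroup K] [InnerProductSpace ℂ K]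

/-- `𝔥 = 𝔎 ⊗ L²(0,∞)`, realized as the square integrable `𝔎`-valued functions on `(0,∞)`. -/
def HS : Type _ := Lp K 2 halfLine

instance : NormedAddCommGroup (HS K) := inferInstanceAs (NormedAddCommGroup (Lp K 2 halfLine))

instance : InnerProductSpace ℂ (HS K) := inferInstanceAs (InnerProductSpace ℂ (Lp K 2 halfLine))

instance [CompleteSpace K] : CompleteSpace (HS K) :=
  inferInstanceAs (CompleteSpace (Lp K 2 halfLine))

variable {K} in
/-- An element of `𝔥`, viewed in the Mathlib space `Lp`. -/
def HS.toLp (f : HS K) : Lp K 2 halfLine := f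

instance : CoeFun (HS K) (fun _ => ℝ → K) := ⟨fun f => (f.toLp : ℝ → K)⟩

variable {K} in
lemma HS.ext {f g : HS K} (h : f =ᵐ[halfLine] g) : f = g := Lp.ext h

variable {K} in
lemma HS.memLp (f : HS K) : MemLp f 2 halfLine := Lp.memLp f.toLp

variable {K} in
lemma HS.inner_def (f g : HS K) : inner ℂ f g = ∫ x, inner ℂ (f x) (g x) ∂halfLine :=
  L2.inner_def (𝕜 := ℂ) f.toLp g.toLp

variable {K} in
lemma HS.coeFn_sub (f g : HS K) : (f - g : HS K) =ᵐ[halfLine] fun x => f x - g x :=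
  Lp.coeFn_sub f.toLp g.toLp

/-- The operator `(A f)(x) = A (f x)`, i.e. `A ⊗ I`, bounded linear in `A`. -/
def ampl : (K →L[ℂ] K) →L[ℂ] (HS K →L[ℂ] HS K) :=
  ContinuousLinearMap.compLpL₂ 2 halfLine (ContinuousLinearMap.id ℂ (K →L[ℂ] K))

/-- Multiplication by an essentially bounded scalar function. -/
def mulOp (φ : ℝ → ℂ) (hφ : MemLp φ ∞ halfLine) : HS K →L[ℂ] HS K :=
  (ContinuousLinearMap.lsmul ℂ ℂ : ℂ →L[ℂ] K →L[ℂ] K).holderL halfLine ∞ 2 2 hφ.toLp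

variable {K}

lemma coeFn_mulOp (φ : ℝ → ℂ) (hφ : MemLp φ ∞ halfLine) (f : HS K) :
    mulOp K φ hφ f =ᵐ[halfLine] fun x => φ x • f x := by
  have h := (ContinuousLinearMap.lsmul ℂ ℂ : ℂ →L[ℂ] K →L[ℂ] K).coeFn_holder (r := 2)
    hφ.toLp f.toLp
  filter_upwards [h, hφ.coeFn_toLp] with x h1 h2
  rw [← h2]
  exact h1

lemma mulOp_mul {φ ψ χ : ℝ → ℂ} (hφ : MemLp φ ∞ halfLine) (hψ : MemLp ψ ∞ halfLine)
    (hχ : MemLp χ ∞ halfLine) (h : ∀ x ∈ Ioi (0 : ℝ), φ x * ψ x = χ x) :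
    mulOp K φ hφ * mulOp K ψ hψ = mulOp K χ hχ := by
  ext1 f
  apply HS.ext
  have h0 : ∀ᵐ x ∂halfLine, x ∈ Ioi (0 : ℝ) := ae_restrict_mem measurableSet_Ioi
  filter_upwards [coeFn_mulOp φ hφ (mulOp K ψ hψ f), coeFn_mulOp ψ hψ f, coeFn_mulOp χ hχ f, h0]
    with x h1 h2 h3 h4
  rw [_root_.mul_apply_eq_comp, h1, h2, h3, smul_smul, h x h4]

lemma memLp_of_le {φ : ℝ → ℂ} (hm : Measurable φ) (C : ℝ)
    (h : ∀ x ∈ Ioi (0 : ℝ), ‖φ x‖ ≤ C) : MemLp φ ∞ halfLine :=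
  memLp_top_of_bound hm.aestronglyMeasurable C
    ((ae_restrict_mem measurableSet_Ioi).mono fun x hx => h x hx)

/-- The function `x ↦ e^{-x}`. -/
def expFn (x : ℝ) : ℂ := (Real.exp (-x) : ℝ)

lemma memLp_expFn : MemLp expFn ∞ halfLine := by
  refine memLp_of_le (by unfold expFn; fun_prop) 1 fun x hx => ?_
  have hx : (0 : ℝ) < x := hx
  simp only [expFn, Complex.norm_real, Real.norm_eq_abs, Real.abs_exp, Real.exp_le_one_iff]
  linarith

/-- `Λ(A)` is the operator `(Λ(A) f)(x) = e^{-x} A f(x)`; `Λ : B(𝔎) → B(𝔥)` is bounded linear. -/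
def Lam : (K →L[ℂ] K) →L[ℂ] (HS K →L[ℂ] HS K) :=
  (ContinuousLinearMap.mul ℂ (HS K →L[ℂ] HS K) (mulOp K expFn memLp_expFn)).comp (ampl K)

lemma coeFn_Lam (A : K →L[ℂ] K) (f : HS K) :
    Lam A f =ᵐ[halfLine] fun x => expFn x • A (f x) := by
  have h0 : ampl K A f =ᵐ[halfLine] fun x => A (f x) :=
    A.coeFn_compLp f.toLp
  filter_upwards [coeFn_mulOp expFn memLp_expFn (ampl K A f), h0] with x h1 h2
  rw [← h2, ← h1]
  rfl

/-- The indicator function of `(t,∞)`. -/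
def cutFn (t : ℝ) : ℝ → ℂ := (Ioi t).indicator fun _ => 1

lemma memLp_cutFn (t : ℝ) : MemLp (cutFn t) ∞ halfLine := by
  refine memLp_of_le (measurable_const.indicator measurableSet_Ioi) 1 fun x _ => ?_
  by_cases h : x ∈ Ioi t <;> simp [cutFn, h]

variable (K) in
/-- `E(t,∞) = S_t S_t^*`, the projection of `𝔥` onto the functions that vanish outside `(t,∞)`
(the range of the right shift `S_t`). -/
def Ecut (t : ℝ) : HS K →L[ℂ] HS K := mulOp K (cutFn t) (memLp_cutFn t)

lemma inner_mulOp (φ : ℝ → ℂ) (hφ : MemLp φ ∞ halfLine) (f g : HS K) :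
    inner ℂ f (mulOp K φ hφ g) = ∫ x, φ x * inner ℂ (f x) (g x) ∂halfLine := by
  rw [HS.inner_def]
  refine integral_congr_ae ?_
  filter_upwards [coeFn_mulOp φ hφ g] with x hx
  rw [hx, inner_smul_right]

end Operators

/-! ### The algebra `𝔄(𝔥)` and boundary weights -/

section BoundaryWeights

variable (K : Type*) [NormedAddCommGroup K] [InnerProductSpace ℂ K] [CompleteSpace K]

/-- The positive square root `(I - Λ(I))^{1/2}`. -/
def rootOp : HS K →L[ℂ] HS K := opSqrt (1 - Lam (1 : K →L[ℂ] K))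

/-- The function `x ↦ (1 - e^{-x})^{1/2}`. -/
def rootFn (x : ℝ) : ℂ := (Real.sqrt (1 - Real.exp (-x)) : ℝ)

lemma memLp_rootFn : MemLp rootFn ∞ halfLine := by
  refine memLp_of_le (by unfold rootFn; fun_prop) 1 fun x _ => ?_
  simp only [rootFn, Complex.norm_real, Real.norm_eq_abs, abs_of_nonneg (Real.sqrt_nonneg _)]
  rw [Real.sqrt_le_iff]
  refine ⟨zero_le_one, ?_⟩
  linarith [Real.exp_pos (-x)]

variable {K} in
lemma mulOp_nonneg {φ : ℝ → ℂ} (hφ : MemLp φ ∞ halfLine) (h : ∀ x, 0 ≤ φ x) :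
    0 ≤ mulOp K φ hφ := by
  rw [ContinuousLinearMap.nonneg_iff_isPositive, ContinuousLinearMap.isPositive_iff_complex]
  intro f
  have key : (0 : ℂ) ≤ inner ℂ (mulOp K φ hφ f) f := by
    rw [← inner_conj_symm, inner_mulOp]
    have h1 : ∀ x, φ x * inner ℂ (f x) (f x) = (((φ x).re * ‖f x‖ ^ 2 : ℝ) : ℂ) := by
      intro x
      have hx := (Complex.nonneg_iff.1 (h x)).2
      rw [inner_self_eq_norm_sq_to_K]
      apply Complex.ext <;> simp [← hx, ← Complex.ofReal_pow]
    simp_rw [h1]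
    rw [integral_complex_ofReal, Complex.conj_ofReal, Complex.zero_le_real]
    exact integral_nonneg fun x => mul_nonneg (Complex.nonneg_iff.1 (h x)).1 (by positivity)
  obtain ⟨h1, h2⟩ := Complex.nonneg_iff.1 key
  refine ⟨?_, h1⟩
  apply Complex.ext <;> simp [← h2]

lemma rootFn_sq : mulOp K rootFn memLp_rootFn * mulOp K rootFn memLp_rootFn
    = 1 - Lam (1 : K →L[ℂ] K) := by
  ext1 f
  apply HS.ext
  have h0 : ∀ᵐ x ∂halfLine, x ∈ Ioi (0 : ℝ) := ae_restrict_mem measurableSet_Ioi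
  have hsub := HS.coeFn_sub f (Lam (1 : K →L[ℂ] K) f)
  filter_upwards [coeFn_mulOp rootFn memLp_rootFn (mulOp K rootFn memLp_rootFn f),
    coeFn_mulOp rootFn memLp_rootFn f, coeFn_Lam (1 : K →L[ℂ] K) f, hsub, h0] with x h1 h2 h3 h4 h5
  have h5 : (0 : ℝ) < x := h5
  have hx : Real.exp (-x) ≤ 1 := Real.exp_le_one_iff.2 (by linarith)
  have hr : rootFn x * rootFn x = 1 - expFn x := by
    simp only [rootFn, expFn, ← Complex.ofReal_mul]
    rw [Real.mul_self_sqrt (by linarith)]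
    push_cast
    rfl
  rw [_root_.mul_apply_eq_comp, h1, h2, smul_smul, hr, _root_.sub_apply,
    _root_.one_apply_eq_self, h4, h3, _root_.one_apply_eq_self, sub_smul,
    one_smul]

lemma rootOp_eq : rootOp K = mulOp K rootFn memLp_rootFn := by
  have hpos : 0 ≤ mulOp K rootFn memLp_rootFn :=
    mulOp_nonneg _ fun x => Complex.zero_le_real.2 (Real.sqrt_nonneg _)
  exact opSqrt_unique (rootFn_sq K) hpos

/-- The linear map `A ↦ (I - Λ)^{1/2} A (I - Λ)^{1/2}` on `B(𝔥)`. -/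
def compress : (HS K →L[ℂ] HS K) →ₗ[ℂ] (HS K →L[ℂ] HS K) :=
  LinearMap.mulLeftRight ℂ (rootOp K, rootOp K)

/-- `𝔄(𝔥) = (I - Λ)^{1/2} B(𝔥) (I - Λ)^{1/2}`. -/
def bdAlg : Submodule ℂ (HS K →L[ℂ] HS K) := LinearMap.range (compress K)

variable {K}

/-- `(I - Λ)^{1/2} A (I - Λ)^{1/2}` as an element of `𝔄(𝔥)`. -/
def toBdAlg (A : HS K →L[ℂ] HS K) : bdAlg K := ⟨rootOp K * A * rootOp K, A, rfl⟩

variable (K) in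
/-- The space `𝔄(𝔥)_*` of boundary weights: linear functionals `μ` on `𝔄(𝔥)` for which
`A ↦ μ((I - Λ)^{1/2} A (I - Λ)^{1/2})` is a normal bounded functional on `B(𝔥)`. -/
def BoundaryWeight : Submodule ℂ (bdAlg K →ₗ[ℂ] ℂ) where
  carrier := {μ | ∃ ℓ ∈ Predual (HS K), ∀ A, ℓ A = μ (toBdAlg A)}
  zero_mem' := ⟨0, zero_mem _, fun _ => rfl⟩
  add_mem' := by
    rintro μ ν ⟨ℓ, hℓ, h⟩ ⟨m, hm, k⟩
    exact ⟨ℓ + m, add_mem hℓ hm, fun A => by simp [h, k]⟩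
  smul_mem' := by
    rintro c μ ⟨ℓ, hℓ, h⟩
    exact ⟨c • ℓ, Submodule.smul_mem _ c hℓ, fun A => by simp [h]⟩

/-- The function `1_{(t,∞)}(x) (1 - e^{-x})^{-1/2}`. -/
def invRootFn (t : ℝ) : ℝ → ℂ :=
  (Ioi t).indicator fun x => ((Real.sqrt (1 - Real.exp (-x)))⁻¹ : ℝ)

lemma memLp_invRootFn {t : ℝ} (ht : 0 < t) : MemLp (invRootFn t) ∞ halfLine := by
  refine memLp_of_le (Measurable.indicator (by fun_prop) measurableSet_Ioi)
    (Real.sqrt (1 - Real.exp (-t)))⁻¹ fun x _ => ?_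
  have hpos : 0 < 1 - Real.exp (-t) := by
    have := Real.exp_lt_one_iff.2 (show -t < 0 by linarith)
    linarith
  by_cases h : x ∈ Ioi t
  · rw [invRootFn, indicator_of_mem h, Complex.norm_real, Real.norm_eq_abs,
      abs_of_nonneg (by positivity)]
    have h' : t < x := h
    refine inv_anti₀ (Real.sqrt_pos.2 hpos) (Real.sqrt_le_sqrt ?_)
    have := Real.exp_le_exp.2 (show -x ≤ -t by linarith)
    linarith
  · rw [invRootFn, indicator_of_notMem h]
    simp

variable (K) in
/-- The bounded operator `(I - Λ)^{-1/2} E(t,∞)`. -/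
def invRootOp {t : ℝ} (ht : 0 < t) : HS K →L[ℂ] HS K :=
  mulOp K (invRootFn t) (memLp_invRootFn ht)

lemma root_inv_aux {t : ℝ} (ht : 0 < t) (x : ℝ) : rootFn x * invRootFn t x = cutFn t x := by
  by_cases h : x ∈ Ioi t
  · have h' : t < x := h
    have hpos : 0 < 1 - Real.exp (-x) := by
      have := Real.exp_lt_one_iff.2 (show -x < 0 by linarith)
      linarith
    rw [invRootFn, cutFn, indicator_of_mem h, indicator_of_mem h, rootFn, ← Complex.ofReal_mul,
      mul_inv_cancel₀ (Real.sqrt_pos.2 hpos).ne', Complex.ofReal_one]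
  · rw [invRootFn, cutFn, indicator_of_notMem h, indicator_of_notMem h, mul_zero]

lemma root_mul_invRoot {t : ℝ} (ht : 0 < t) : rootOp K * invRootOp K ht = Ecut K t := by
  rw [rootOp_eq]
  exact mulOp_mul _ _ _ fun x _ => root_inv_aux ht x

lemma invRoot_mul_root {t : ℝ} (ht : 0 < t) : invRootOp K ht * rootOp K = Ecut K t := by
  rw [rootOp_eq]
  exact mulOp_mul _ _ _ fun x _ => by rw [mul_comm, root_inv_aux ht x]

/-- The map `A ↦ E(t,∞) A E(t,∞)` on `B(𝔥)`. -/
def cutLin (t : ℝ) : (HS K →L[ℂ] HS K) →ₗ[ℂ] (HS K →L[ℂ] HS K) :=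
  LinearMap.mulLeftRight ℂ (Ecut K t, Ecut K t)

lemma cutLin_eq {t : ℝ} (ht : 0 < t) (A : HS K →L[ℂ] HS K) :
    cutLin t A = rootOp K * (invRootOp K ht * A * invRootOp K ht) * rootOp K := by
  have : cutLin t A = Ecut K t * A * Ecut K t := rfl
  rw [this]
  nth_rw 1 [← root_mul_invRoot ht]
  rw [← invRoot_mul_root ht]
  simp only [mul_assoc]

lemma cutLin_mem {t : ℝ} (ht : 0 < t) (A : HS K →L[ℂ] HS K) : cutLin t A ∈ bdAlg K :=
  ⟨_, (cutLin_eq ht A).symm⟩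

open Classical in
/-- For `t > 0`, `cut t A` is `A|_t = E(t,∞) A E(t,∞)` as an element of `𝔄(𝔥)`. (The value for
`t ≤ 0` is a placeholder and is never used.) -/
def cut (t : ℝ) : (HS K →L[ℂ] HS K) →ₗ[ℂ] bdAlg K :=
  if ht : 0 < t then LinearMap.codRestrict (bdAlg K) (cutLin t) (cutLin_mem ht) else 0

lemma coe_cut {t : ℝ} (ht : 0 < t) (A : HS K →L[ℂ] HS K) :
    (cut t A : HS K →L[ℂ] HS K) = Ecut K t * A * Ecut K t := by
  simp only [cut, dif_pos ht]
  rfl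

lemma cut_eq {t : ℝ} (ht : 0 < t) (A : HS K →L[ℂ] HS K) :
    cut t A = toBdAlg (invRootOp K ht * A * invRootOp K ht) := by
  apply Subtype.ext
  rw [coe_cut ht]
  exact cutLin_eq ht A

/-- The bounded map `A ↦ C A C` on `B(𝔥)`. -/
def sandwich (C : HS K →L[ℂ] HS K) : (HS K →L[ℂ] HS K) →L[ℂ] (HS K →L[ℂ] HS K) :=
  ContinuousLinearMap.mulLeftRight ℂ (HS K →L[ℂ] HS K) C C

lemma sandwich_mem {η : (HS K →L[ℂ] HS K) →L[ℂ] ℂ} (hη : η ∈ Predual (HS K))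
    (C : HS K →L[ℂ] HS K) : η.comp (sandwich C) ∈ Predual (HS K) := by
  refine comp_mem_predual _ (fun f g => ?_) hη
  have : (vecFun f g).comp (sandwich C)
      = vecFun (ContinuousLinearMap.adjoint C f) (C g) := by
    ext A
    simp [sandwich, ContinuousLinearMap.adjoint_inner_left]
  rw [this]
  exact vecFun_mem _ _

lemma exists_trunc (μ : BoundaryWeight K) (t : ℝ) :
    ∃ m ∈ Predual (HS K), ∀ A, m A = μ.1 (cut t A) := by
  by_cases ht : 0 < t
  · obtain ⟨ℓ, hℓ, h⟩ := μ.2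
    refine ⟨_, sandwich_mem hℓ (invRootOp K ht), fun A => ?_⟩
    rw [cut_eq ht, ← h]
    rfl
  · exact ⟨0, zero_mem _, fun A => by simp [cut, ht]⟩

/-- The truncation `μ|_t ∈ B(𝔥)_*` of a boundary weight: `μ|_t(A) = μ(E(t,∞) A E(t,∞))`. -/
def trunc (t : ℝ) : BoundaryWeight K →ₗ[ℂ] Predual (HS K) where
  toFun μ := ⟨(exists_trunc μ t).choose, (exists_trunc μ t).choose_spec.1⟩
  map_add' μ ν := by
    apply Subtype.ext
    ext1 A
    change (exists_trunc (μ + ν) t).choose A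
      = (exists_trunc μ t).choose A + (exists_trunc ν t).choose A
    rw [(exists_trunc (μ + ν) t).choose_spec.2, (exists_trunc μ t).choose_spec.2,
      (exists_trunc ν t).choose_spec.2]
    rfl
  map_smul' c μ := by
    apply Subtype.ext
    ext1 A
    change (exists_trunc (c • μ) t).choose A = c * (exists_trunc μ t).choose A
    rw [(exists_trunc (c • μ) t).choose_spec.2, (exists_trunc μ t).choose_spec.2]
    rfl

lemma trunc_apply (t : ℝ) (μ : BoundaryWeight K) (A : HS K →L[ℂ] HS K) :
    (trunc t μ).1 A = μ.1 (cut t A) := (exists_trunc μ t).choose_spec.2 A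

/-- A Banach space valued function of the form `x ↦ G (f x, g x)` with `‖G (a, b)‖ ≤ ‖a‖ ‖b‖` has
an integral. -/
lemma exists_weak_integral {V : Type*} [NormedAddCommGroup V] [NormedSpace ℂ V] [CompleteSpace V]
    (G : K × K → V) (hG : Continuous G) (hb : ∀ p, ‖G p‖ ≤ ‖p.1‖ * ‖p.2‖) (f g : HS K) :
    ∃ v : V, ∀ L : V →L[ℂ] ℂ, L v = ∫ x, L (G (f x, g x)) ∂halfLine := by
  have hmeas : AEStronglyMeasurable (fun x => G (f x, g x)) halfLine :=
    hG.comp_aestronglyMeasurable ((HS.memLp f).1.prodMk (HS.memLp g).1)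
  have h2 : Integrable (fun x => ‖f x‖ * ‖g x‖) halfLine :=
    (HS.memLp f).norm.integrable_mul (HS.memLp g).norm
  have hint : Integrable (fun x => G (f x, g x)) halfLine :=
    h2.mono' hmeas (Eventually.of_forall fun x => hb _)
  exact ⟨_, fun L => (L.integral_comp_comm hint).symm⟩

lemma Lam_vecFun_mem (f g : HS K) : (vecFun f g).comp Lam ∈ Predual K := by
  let g' : HS K := mulOp K expFn memLp_expFn g
  have : CompleteSpace (Predual K) := isClosed_predual.completeSpace_coe
  obtain ⟨v, hv⟩ := exists_weak_integral (V := Predual K)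
    (fun p : K × K => ⟨vecFun p.1 p.2, vecFun_mem _ _⟩) (continuous_vecFun.subtype_mk _)
    (fun p => norm_vecFun_le p.1 p.2) f g'
  have heq : (vecFun f g).comp Lam = v.1 := by
    ext A
    have h3 : v.1 A = ∫ x, inner ℂ (f x) (A (g' x)) ∂halfLine :=
      hv ((ContinuousLinearMap.apply ℂ ℂ A).comp (Predual K).subtypeL)
    rw [h3, ContinuousLinearMap.comp_apply, vecFun_apply, HS.inner_def]
    refine integral_congr_ae ?_
    filter_upwards [coeFn_Lam A g, coeFn_mulOp expFn memLp_expFn g] with x h4 h5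
    rw [h4]
    rw [h5, map_smul]
  rw [heq]
  exact v.2

/-- The predual map `Λ̂ : B(𝔥)_* → B(𝔎)_*`, `Λ̂(η)(A) = η(Λ(A))`. -/
def LamHat : Predual (HS K) →ₗ[ℂ] Predual K where
  toFun η := ⟨η.1.comp Lam, comp_mem_predual Lam Lam_vecFun_mem η.2⟩
  map_add' _ _ := rfl
  map_smul' _ _ := rfl

/-- A boundary weight is positive if it is nonnegative on the positive elements of `𝔄(𝔥)`. -/
def IsPos (μ : BoundaryWeight K) : Prop :=
  ∀ T : bdAlg K, 0 ≤ (T : HS K →L[ℂ] HS K) → 0 ≤ μ.1 T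

variable (K) in
/-- `I - Λ(I)` as an element of `𝔄(𝔥)`. -/
def oneSubLam : bdAlg K := toBdAlg 1

lemma coe_oneSubLam : (oneSubLam K : HS K →L[ℂ] HS K) = 1 - Lam (1 : K →L[ℂ] K) := by
  have : (oneSubLam K : HS K →L[ℂ] HS K) = rootOp K * 1 * rootOp K := rfl
  rw [this, mul_one, rootOp_eq, rootFn_sq]

/-- `HasValue μ T x`: the boundary weight `μ` assigns the (finite) value `x` to the operator `T` of
`B(𝔥)`, which need not belong to `𝔄(𝔥)`: `μ(T|_t) → x` as `t → 0+`. -/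
def HasValue (μ : BoundaryWeight K) (T : HS K →L[ℂ] HS K) (x : ℝ) : Prop :=
  Tendsto (fun t : ℝ => μ.1 (cut t T)) (𝓝[>] 0) (𝓝 (x : ℂ))

end BoundaryWeights

/-! ### Complete positivity and `q`-weight maps -/

section QWeights

/-- Positivity of an operator matrix `(T i j)` in `M_n(B(E))`. -/
def MatPos {E : Type*} [NormedAddCommGroup E] [InnerProductSpace ℂ E] {n : ℕ}
    (T : Fin n → Fin n → E →L[ℂ] E) : Prop :=
  ∀ f : Fin n → E, 0 ≤ ∑ i, ∑ j, inner ℂ (f i) (T i j (f j))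

/-- Positivity of a matrix of normal functionals, as a functional on `M_n(B(E))`. -/
def PredualMatPos {E : Type*} [NormedAddCommGroup E] [InnerProductSpace ℂ E] {n : ℕ}
    (ρ : Fin n → Fin n → Predual E) : Prop :=
  ∀ T : Fin n → Fin n → E →L[ℂ] E, MatPos T → 0 ≤ ∑ i, ∑ j, (ρ i j).1 (T i j)

variable {K : Type*} [NormedAddCommGroup K] [InnerProductSpace ℂ K] [CompleteSpace K]

/-- Positivity of a matrix of boundary weights, as a functional on `M_n(𝔄(𝔥))`. -/
def WeightMatPos {n : ℕ} (μ : Fin n → Fin n → BoundaryWeight K) : Prop :=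
  ∀ T : Fin n → Fin n → bdAlg K, MatPos (fun i j => (T i j : HS K →L[ℂ] HS K)) →
    0 ≤ ∑ i, ∑ j, (μ i j).1 (T i j)

/-- Complete positivity of a boundary weight map `B(𝔎)_* → 𝔄(𝔥)_*`. -/
def IsCPWeightMap (ω : Predual K →ₗ[ℂ] BoundaryWeight K) : Prop :=
  ∀ (n : ℕ) (ρ : Fin n → Fin n → Predual K), PredualMatPos ρ →
    WeightMatPos fun i j => ω (ρ i j)

/-- Complete positivity of a linear map `B(𝔎)_* → B(𝔥)_*`. -/
def IsCPPredualMap (φ : Predual K →ₗ[ℂ] Predual (HS K)) : Prop :=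
  ∀ (n : ℕ) (ρ : Fin n → Fin n → Predual K), PredualMatPos ρ →
    PredualMatPos fun i j => φ (ρ i j)

/-- The operator `I + Λ̂ ω|_t` on `B(𝔎)_*`. -/
def onePlus (ω : Predual K →ₗ[ℂ] BoundaryWeight K) (t : ℝ) : Module.End ℂ (Predual K) :=
  1 + LamHat ∘ₗ trunc t ∘ₗ ω

/-- `π̂_t = ω|_t (I + Λ̂ ω|_t)⁻¹` (meaningful when `I + Λ̂ ω|_t` is invertible). -/
def piHat (ω : Predual K →ₗ[ℂ] BoundaryWeight K) (t : ℝ) : Predual K →ₗ[ℂ] Predual (HS K) :=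
  (trunc t ∘ₗ ω) ∘ₗ Ring.inverse (onePlus ω t)

/-- `q`-weight maps: completely positive boundary weight maps `ω` with
`ω(ρ)(I - Λ) ≤ ρ(I)` for all positive `ρ`, such that for every `t > 0` the map `I + Λ̂ ω|_t` is
invertible and `π̂_t` is a completely positive contraction. -/
structure IsQWeight (ω : Predual K →ₗ[ℂ] BoundaryWeight K) : Prop where
  cp : IsCPWeightMap ω
  le : ∀ ρ : Predual K, (∀ A : K →L[ℂ] K, 0 ≤ A → 0 ≤ ρ.1 A) →
    (ω ρ).1 (oneSubLam K) ≤ ρ.1 1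
  invertible : ∀ t : ℝ, 0 < t → IsUnit (onePlus ω t)
  piHat_cp : ∀ t : ℝ, 0 < t → IsCPPredualMap (piHat ω t)
  piHat_contraction : ∀ t : ℝ, 0 < t → ∀ ρ : Predual K, ‖piHat ω t ρ‖ ≤ ‖ρ‖

/-- `ω` has range rank `n`: the range of its dualized map `ω̆ : 𝔄(𝔥) → B(𝔎)`, given by
`ρ(ω̆(T)) = ω(ρ)(T)`, has dimension `n`. -/
def HasRangeRank (ω : Predual K →ₗ[ℂ] BoundaryWeight K) (n : ℕ) : Prop :=
  ∃ Φ : bdAlg K →ₗ[ℂ] (K →L[ℂ] K), (∀ (ρ : Predual K) (T : bdAlg K), ρ.1 (Φ T) = (ω ρ).1 T) ∧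
    Module.rank ℂ (LinearMap.range Φ) = n

/-! ### The data attached to a pair of weights -/

/-- The function `h(t) = μ(Λ(e)|_t) / (1 + ν(Λ(e)|_t))`. -/
def hFun (μ ν : BoundaryWeight K) (e : K →L[ℂ] K) (t : ℝ) : ℝ :=
  (μ.1 (cut t (Lam e))).re / (1 + (ν.1 (cut t (Lam e))).re)

/-- The parallelogram in the `(x,y)`-plane with opposite vertices `(0,0)` and `(1,1)` and sides
parallel to the lines `x = κ₁ y` and `y = κ₂ x`. Its edges from `(0,0)` are `a (κ₁, 1)` and
`b (1, κ₂)`, where `a, b ≥ 0` and the two edges add up to `(1,1)`. -/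
def parallelogram (κ₁ κ₂ : ℝ) : Set (ℝ × ℝ) :=
  {p | ∃ a b : ℝ, 0 ≤ a ∧ 0 ≤ b ∧ a • (κ₁, 1) + b • (1, κ₂) = ((1, 1) : ℝ × ℝ) ∧
    ∃ s ∈ Icc (0 : ℝ) 1, ∃ r ∈ Icc (0 : ℝ) 1, p = s • a • (κ₁, (1 : ℝ)) + r • b • ((1 : ℝ), κ₂)}

/-- The conditions on the weights: `κ₁ = sup h₁` and `κ₂ = sup h₂` (finite suprema) lie in `[0,1]`,
`μ₁ ≥ κ₁ μ₂` and `μ₂ ≥ κ₂ μ₁`, and the values `x` and `y` of `μ₁` and `μ₂` on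
`I - Λ(e₁ + e₂)` (exist, are finite and) form a point of the parallelogram. -/
structure RankTwoConditions (e₁ e₂ : K →L[ℂ] K) (μ₁ μ₂ : BoundaryWeight K) (κ₁ κ₂ : ℝ) :
    Prop where
  sup₁ : IsLUB (hFun μ₁ μ₂ e₂ '' Ioi 0) κ₁
  sup₂ : IsLUB (hFun μ₂ μ₁ e₁ '' Ioi 0) κ₂
  mem₁ : κ₁ ∈ Icc (0 : ℝ) 1
  mem₂ : κ₂ ∈ Icc (0 : ℝ) 1
  ge₁ : IsPos (μ₁ - (κ₁ : ℂ) • μ₂)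
  ge₂ : IsPos (μ₂ - (κ₂ : ℂ) • μ₁)
  normalized : ∃ x y : ℝ, HasValue μ₁ (1 - Lam (e₁ + e₂)) x ∧
    HasValue μ₂ (1 - Lam (e₁ + e₂)) y ∧ (x, y) ∈ parallelogram κ₁ κ₂

end QWeights

end CPFlow

end

noncomputable section

namespace CPFlow

/-! ### Positive functionals, and positive matrices of functionals -/

section PositiveFunctionals

variable {E : Type*} [NormedAddCommGroup E] [InnerProductSpace ℂ E]

/-! Fix `t`. Since `ω` sees `ρ` only through `ρ(e₁)` and `ρ(e₂)`, inverting `I + Λ̂ω|_t` is a `2 ×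
2` linear problem. Cramer's rule gives (`piHat_apply`) D π̂_t(σ) = σ(e₁) N₁ + σ(e₂) N₂, with D =
`pairDet` and N₁, N₂ two instances of `pairNum`. Moreover N₁ = (1 + μ₂(Λ(e₂)|_t)) (μ₁|_t − h₁(t)
μ₂|_t), symmetrically for N₂, and D is a positive factor times 1 − h₁(t)h₂(t).

The hypothesis on `e₁, e₂` enters only through `IsSquarePair`: `e₁ + e₂ ≤ I`, and vector states
bring (⟨e₁⟩, ⟨e₂⟩) arbitrarily close to (1,0) and to (0,1). So positivity of π̂_t separates into
positivity of N₁/D and of N₂/D, that is, μᵢ|_t ≥ hᵢ(t) μⱼ|_t once D > 0. Dually, π̂_t is A ↦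
(N₁(A)e₁ + N₂(A)e₂)/D, whose norm is controlled by the norms of the positive functionals Nᵢ/D,
attained at the identity. Hence contractivity amounts to Nᵢ(1) ≤ D, which simplifies to (μᵢ − hᵢ(t)
μⱼ)((I − Λ(e₁+e₂))|_t) ≤ 1 − hᵢ(t) (`pairNum_one_le_pairDet_iff`).

For a q-weight these inequalities hold at every `t`. They make hᵢ non-increasing and bounded by 1,
and the limit t → 0+ yields (a), (b), (c). Conversely, since hᵢ(t) ≤ κᵢ, the decomposition μᵢ −
hᵢ(t)μⱼ = (μᵢ − κᵢμⱼ) + (κᵢ − hᵢ(t))μⱼ brings the limiting conditions back to each `t`. It remains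
to know D > 0. This is clear when both κᵢ < 1. If some κᵢ = 1, the difference of the weights is of
one sign and vanishes on I − Λ(e₁+e₂), which dominates I − Λ, so the weights coincide and D = 1 +
μ(Λ(e₁)|_t) + μ(Λ(e₂)|_t). -/

lemma nonneg_iff_inner {T : E →L[ℂ] E} : 0 ≤ T ↔ ∀ f : E, 0 ≤ inner ℂ f (T f) := by
  rw [ContinuousLinearMap.nonneg_iff_isPositive, ContinuousLinearMap.isPositive_iff_complex]
  refine forall_congr' fun f => ?_
  rw [← inner_conj_symm f (T f), Complex.nonneg_iff]
  constructor
  · rintro ⟨h1, h2⟩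
    refine ⟨h2, ?_⟩
    rw [← h1]
    simp
  · rintro ⟨h1, h2⟩
    refine ⟨?_, h1⟩
    apply Complex.ext
    · simp
    · simp only [Complex.conj_im] at h2
      simpa [eq_comm] using h2

variable [CompleteSpace E]

/-- A self-adjoint `A` satisfies `A ≤ ‖A‖·1`, which bounds the real part of `η` for every `A`
through its self-adjoint part. A rotation of `A` by a phase then bounds the modulus. -/
lemma norm_le_of_positive (η : (E →L[ℂ] E) →ₗ[ℂ] ℂ) (hη : ∀ A, 0 ≤ A → 0 ≤ η A)
    (A : E →L[ℂ] E) : ‖η A‖ ≤ ‖A‖ * (η 1).re := by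
  have hmono : ∀ {A B : E →L[ℂ] E}, A ≤ B → η A ≤ η B := fun {A B} h => by
    have := hη _ (sub_nonneg.2 h)
    rwa [map_sub, sub_nonneg] at this
  have hsa : ∀ A : E →L[ℂ] E, IsSelfAdjoint A → (η A).im = 0 ∧ (η A).re ≤ ‖A‖ * (η 1).re := by
    intro A hA
    have h1 : η A ≤ (‖A‖ : ℂ) * η 1 := by
      have h := hmono hA.le_algebraMap_norm_self
      have h' : algebraMap ℝ (E →L[ℂ] E) ‖A‖ = (‖A‖ : ℂ) • (1 : E →L[ℂ] E) := by
        rw [Algebra.algebraMap_eq_smul_one]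
        ext; simp
      rwa [h', map_smul, smul_eq_mul] at h
    have h2 := Complex.nonneg_iff.1 (hη 1 zero_le_one)
    have h3 := Complex.le_def.1 h1
    have hre : ((‖A‖ : ℂ) * η 1).re = ‖A‖ * (η 1).re := by simp
    have him : ((‖A‖ : ℂ) * η 1).im = 0 := by simp [← h2.2]
    exact ⟨h3.2.trans him, h3.1.trans hre.le⟩
  have hre : ∀ A : E →L[ℂ] E, (η A).re ≤ ‖A‖ * (η 1).re := by
    intro A
    have h0 : (η A).re = (η (realPart A : E →L[ℂ] E)).re := by
      conv_lhs => rw [← realPart_add_I_smul_imaginaryPart A]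
      rw [map_add, map_smul]
      simp [(hsa _ (imaginaryPart A).2).1]
    rw [h0]
    refine (hsa _ (realPart A).2).2.trans ?_
    have := (Complex.nonneg_iff.1 (hη 1 zero_le_one)).1
    gcongr
    exact realPart.norm_le A
  by_cases h0 : η A = 0
  · rw [h0, norm_zero]
    exact mul_nonneg (norm_nonneg _) (Complex.nonneg_iff.1 (hη 1 zero_le_one)).1
  -- The phase for which `η (c • A) = ‖η A‖`.
  · let c : ℂ := (starRingEnd ℂ (η A)) / ‖η A‖
    have hn : (‖η A‖ : ℂ) ≠ 0 := by simpa using h0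
    have hc : ‖c‖ = 1 := by simp [c, h0]
    have h1 : η (c • A) = ‖η A‖ := by
      rw [map_smul, smul_eq_mul, div_mul_eq_mul_div, div_eq_iff hn, mul_comm,
        Complex.mul_conj, Complex.normSq_eq_norm_sq]
      push_cast
      ring
    have h2 := hre (c • A)
    rwa [h1, norm_smul, hc, one_mul, Complex.ofReal_re] at h2

/-- A nonnegative operator gives a positive semidefinite matrix under a positive matrix of
functionals. -/
lemma PredualMatPos.posSemidef {n : ℕ} {ρ : Fin n → Fin n → Predual E} (hρ : PredualMatPos ρ)
    {e : E →L[ℂ] E} (he : 0 ≤ e) : (Matrix.of fun i j => (ρ i j).1 e).PosSemidef := by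
  rw [← Matrix.isPositive_toEuclideanLin_iff, LinearMap.isPositive_iff_complex]
  intro x
  have key : (0 : ℂ) ≤ inner ℂ x (Matrix.toEuclideanLin (Matrix.of fun i j => (ρ i j).1 e) x) := by
    -- The test matrix is a rank-one scalar matrix times `e`. Its quadratic form at `f` is that of
    -- `e` at `∑ xᵢ fᵢ`, hence positive.
    have h := hρ (fun i j => (starRingEnd ℂ (x i) * x j) • e) ?_
    · convert h using 1
      simp only [PiLp.inner_apply, Matrix.toLpLin_apply, Matrix.mulVec, dotProduct, map_smul,
        Matrix.of_apply, RCLike.inner_apply, smul_eq_mul, Finset.sum_mul]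
      exact Finset.sum_congr rfl fun i _ => Finset.sum_congr rfl fun j _ => by ring
    · intro f
      have h2 := nonneg_iff_inner.1 he (∑ i, x i • f i)
      convert h2 using 1
      simp only [map_sum, sum_inner, inner_sum, map_smul, inner_smul_left, inner_smul_right,
        _root_.smul_apply, Finset.mul_sum]
      rw [Finset.sum_comm]
      exact Finset.sum_congr rfl fun i _ => Finset.sum_congr rfl fun j _ => by ring
  rw [← inner_conj_symm] at key
  obtain ⟨h1, h2⟩ := Complex.nonneg_iff.1 key
  rw [Complex.conj_re] at h1
  rw [Complex.conj_im] at h2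
  refine ⟨?_, h1⟩
  apply Complex.ext
  · simp
  · simpa [eq_comm] using h2

/-- The source of complete positivity for maps ρ ↦ ρ(e) m. A positive semidefinite `C` is a sum of
rank-one matrices, and contracting a positive operator matrix with a rank-one matrix leaves a
positive operator. The map `ι` allows both B(𝔥) and 𝔄(𝔥) as domain of `m`. -/
lemma sum_mul_nonneg_of_posSemidef {V : Type*} [AddCommGroup V] [Module ℂ V]
    (ι : V →ₗ[ℂ] (E →L[ℂ] E)) (m : V →ₗ[ℂ] ℂ) (hm : ∀ T, 0 ≤ ι T → 0 ≤ m T) {n : ℕ}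
    {C : Matrix (Fin n) (Fin n) ℂ} (hC : C.PosSemidef) (T : Fin n → Fin n → V)
    (hT : MatPos fun i j => ι (T i j)) : 0 ≤ ∑ i, ∑ j, C i j * m (T i j) := by
  obtain ⟨N, v, rfl⟩ := Matrix.posSemidef_iff_eq_sum_vecMulVec.1 hC
  have h1 : ∀ k, 0 ≤ m (∑ i, ∑ j, (v k i * starRingEnd ℂ (v k j)) • T i j) := by
    intro k
    refine hm _ (nonneg_iff_inner.2 fun f => ?_)
    convert hT (fun i => starRingEnd ℂ (v k i) • f) using 1
    simp only [map_sum, map_smul, _root_.sum_apply, _root_.smul_apply,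
      inner_sum, inner_smul_left, inner_smul_right, RCLike.conj_conj]
    exact Finset.sum_congr rfl fun i _ => Finset.sum_congr rfl fun j _ => by ring
  have h2 := Finset.sum_nonneg fun k (_ : k ∈ Finset.univ) => h1 k
  convert h2 using 1
  simp only [map_sum, map_smul, smul_eq_mul, Matrix.sum_apply, Matrix.vecMulVec_apply,
    Finset.sum_mul, Pi.star_apply, RCLike.star_def]
  rw [Finset.sum_comm' (t' := Finset.univ) (s' := fun _ => Finset.univ) (by simp)]
  conv_rhs => rw [Finset.sum_comm]
  rw [Finset.sum_comm]
  refine Finset.sum_congr rfl fun i _ => ?_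
  rw [Finset.sum_comm]

end PositiveFunctionals

/-! ### The projections E(t,∞) and the limit t → 0+ -/

section Cut

variable {K : Type*} [NormedAddCommGroup K] [InnerProductSpace ℂ K]

lemma ae_pos_halfLine : ∀ᵐ x ∂halfLine, x ∈ Ioi (0 : ℝ) := ae_restrict_mem measurableSet_Ioi

lemma cutFn_nonneg (t x : ℝ) : 0 ≤ cutFn t x := indicator_nonneg (fun _ _ => zero_le_one) x

lemma Ecut_mul_Ecut (s t : ℝ) : Ecut K s * Ecut K t = Ecut K (max s t) := by
  refine mulOp_mul _ _ _ fun x _ => ?_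
  by_cases hs : s < x <;> by_cases ht : t < x <;> simp [cutFn, hs, ht]

lemma Ecut_mul_Lam (t : ℝ) (A : K →L[ℂ] K) : Ecut K t * Lam A = Lam A * Ecut K t := by
  ext1 f
  apply HS.ext
  filter_upwards [coeFn_mulOp (cutFn t) (memLp_cutFn t) (Lam A f), coeFn_Lam A f,
    coeFn_Lam A (Ecut K t f), coeFn_mulOp (cutFn t) (memLp_cutFn t) f] with x h1 h2 h3 h4
  change (Ecut K t (Lam A f)) x = (Lam A (Ecut K t f)) x
  rw [h3]
  change (mulOp K (cutFn t) (memLp_cutFn t) (Lam A f)) x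
    = expFn x • A ((mulOp K (cutFn t) (memLp_cutFn t) f) x)
  rw [h1, h2, h4, map_smul, smul_comm]

lemma Lam_nonneg {A : K →L[ℂ] K} (hA : 0 ≤ A) : 0 ≤ Lam A := by
  refine nonneg_iff_inner.2 fun f => ?_
  rw [HS.inner_def]
  refine integral_nonneg_of_ae ?_
  filter_upwards [coeFn_Lam A f] with x hx
  rw [hx, inner_smul_right]
  exact mul_nonneg (Complex.zero_le_real.2 (Real.exp_pos _).le) (nonneg_iff_inner.1 hA _)

variable [CompleteSpace K]

lemma Ecut_nonneg (t : ℝ) : 0 ≤ Ecut K t := mulOp_nonneg _ (cutFn_nonneg t)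

lemma Ecut_isSelfAdjoint (t : ℝ) : IsSelfAdjoint (Ecut K t) := .of_nonneg (Ecut_nonneg t)

lemma Ecut_mul_rootOp (t : ℝ) : Ecut K t * rootOp K = rootOp K * Ecut K t := by
  rw [rootOp_eq]
  have h : MemLp (fun x => cutFn t x * rootFn x) ∞ halfLine := by
    exact memLp_rootFn.mul (memLp_cutFn t)
  rw [Ecut, mulOp_mul _ _ h fun x _ => rfl, mulOp_mul _ _ h fun x _ => mul_comm _ _]

lemma norm_Ecut_apply_le (t : ℝ) (f : HS K) : ‖Ecut K t f‖ ≤ ‖f‖ := by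
  have h1 : inner ℂ (Ecut K t f) (Ecut K t f) = inner ℂ f (Ecut K t f) := by
    have h := (Ecut_isSelfAdjoint (K := K) t).isSymmetric f (Ecut K t f)
    have h2 : Ecut K t (Ecut K t f) = Ecut K t f := by
      rw [← _root_.mul_apply_eq_comp, Ecut_mul_Ecut, max_self]
    have h3 : inner ℂ (Ecut K t f) (Ecut K t f) = inner ℂ f (Ecut K t (Ecut K t f)) := h
    rw [h3, h2]
  have h2 : ‖Ecut K t f‖ ^ 2 ≤ ‖f‖ * ‖Ecut K t f‖ := by
    rw [← inner_self_eq_norm_sq (𝕜 := ℂ), h1]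
    exact re_inner_le_norm _ _
  by_contra! h
  nlinarith [norm_nonneg f, norm_nonneg (Ecut K t f)]

/-- For a projection, ‖Ef − f‖² = ⟨f,f⟩ − ⟨f,Ef⟩, and the right-hand side tends to 0 by dominated
convergence. -/
lemma tendsto_Ecut (f : HS K) : Tendsto (fun t => Ecut K t f) (𝓝[>] 0) (𝓝 f) := by
  have h1 : Tendsto (fun t => inner ℂ f (Ecut K t f)) (𝓝[>] 0) (𝓝 (inner ℂ f f)) := by
    simp only [Ecut, inner_mulOp]
    rw [HS.inner_def]
    have hint : Integrable (fun x => inner ℂ (f x) (f x)) halfLine := L2.integrable_inner f.toLp f.toLp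
    refine tendsto_integral_filter_of_dominated_convergence (fun x => ‖inner ℂ (f x) (f x)‖)
      (Eventually.of_forall fun t => ?_) (Eventually.of_forall fun t => ?_) hint.norm ?_
    · exact (memLp_cutFn t).1.mul hint.1
    · refine Eventually.of_forall fun x => ?_
      rw [norm_mul]
      refine mul_le_of_le_one_left (norm_nonneg _) ?_
      by_cases h : x ∈ Ioi t <;> simp [cutFn, h]
    · filter_upwards [ae_pos_halfLine] with x hx
      refine tendsto_const_nhds.congr' ?_
      filter_upwards [mem_nhdsWithin_of_mem_nhds (Iio_mem_nhds hx)] with t ht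
      have : x ∈ Ioi t := ht
      simp [cutFn, this]
  have h2 : ∀ t, ‖Ecut K t f - f‖ ^ 2 = (inner ℂ f f - inner ℂ f (Ecut K t f)).re := by
    intro t
    have hs : inner ℂ (Ecut K t f) f = inner ℂ f (Ecut K t f) :=
      (Ecut_isSelfAdjoint (K := K) t).isSymmetric f f
    have h3 : inner ℂ (Ecut K t f) (Ecut K t f) = inner ℂ f (Ecut K t (Ecut K t f)) :=
      (Ecut_isSelfAdjoint (K := K) t).isSymmetric f (Ecut K t f)
    rw [← _root_.mul_apply_eq_comp, Ecut_mul_Ecut, max_self] at h3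
    rw [← inner_self_eq_norm_sq (𝕜 := ℂ)]
    have h4 : inner ℂ (Ecut K t f - f) (Ecut K t f - f) = inner ℂ f f - inner ℂ f (Ecut K t f) := by
      simp only [inner_sub_left, inner_sub_right, hs, h3]
      ring
    rw [h4]
    rfl
  rw [tendsto_iff_norm_sub_tendsto_zero]
  have h3 : Tendsto (fun t => ‖Ecut K t f - f‖ ^ 2) (𝓝[>] 0) (𝓝 0) := by
    simp_rw [h2]
    have := Complex.continuous_re.continuousAt.tendsto.comp (h1.const_sub (inner ℂ f f))
    rwa [sub_self, Complex.zero_re] at this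
  have h4 := h3.sqrt
  simpa [Real.sqrt_sq (norm_nonneg _)] using h4

/-- On vector functionals this is strong convergence of E(t,∞). The bound ‖E A E‖ ≤ ‖A‖, uniform in
`t`, carries it to the norm closure. -/
lemma tendsto_predual_Ecut {η : (HS K →L[ℂ] HS K) →L[ℂ] ℂ} (hη : η ∈ Predual (HS K))
    (A : HS K →L[ℂ] HS K) :
    Tendsto (fun t => η (Ecut K t * A * Ecut K t)) (𝓝[>] 0) (𝓝 (η A)) := by
  have hb : ∀ t, ‖Ecut K t * A * Ecut K t‖ ≤ ‖A‖ := by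
    have hE : ∀ t, ‖Ecut K t‖ ≤ 1 := fun t =>
      ContinuousLinearMap.opNorm_le_bound _ zero_le_one fun f => by
        rw [one_mul]; exact norm_Ecut_apply_le t f
    intro t
    calc ‖Ecut K t * A * Ecut K t‖ ≤ ‖Ecut K t‖ * ‖A‖ * ‖Ecut K t‖ :=
          (norm_mul_le _ _).trans (by gcongr; exact norm_mul_le _ _)
      _ ≤ 1 * ‖A‖ * 1 := by gcongr <;> exact hE t
      _ = ‖A‖ := by ring
  let S : Submodule ℂ ((HS K →L[ℂ] HS K) →L[ℂ] ℂ) :=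
    { carrier := {η | Tendsto (fun t => η (Ecut K t * A * Ecut K t)) (𝓝[>] 0) (𝓝 (η A))}
      zero_mem' := by simp
      add_mem' := fun h k => h.add k
      smul_mem' := fun c _ h => h.const_mul c }
  have hS : Submodule.span ℂ (Set.range fun p : HS K × HS K => vecFun p.1 p.2) ≤ S := by
    rw [Submodule.span_le]
    rintro _ ⟨⟨f, g⟩, rfl⟩
    change Tendsto (fun t => vecFun f g (Ecut K t * A * Ecut K t)) _ _
    have h : ∀ t, vecFun f g (Ecut K t * A * Ecut K t) = inner ℂ (Ecut K t f) (A (Ecut K t g)) :=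
      fun t => ((Ecut_isSelfAdjoint (K := K) t).isSymmetric f (A (Ecut K t g))).symm
    simp_rw [h]
    exact (tendsto_Ecut f).inner ((A.continuous.tendsto g).comp (tendsto_Ecut g))
  rw [Metric.tendsto_nhds]
  intro ε hε
  -- The summand 1 keeps the denominator nonzero when `A = 0`.
  have hδ : 0 < ε / (3 * (‖A‖ + 1)) := by positivity
  obtain ⟨η', hη', hd⟩ := Metric.mem_closure_iff.1 hη _ hδ
  have h1 : Tendsto (fun t => η' (Ecut K t * A * Ecut K t)) (𝓝[>] 0) (𝓝 (η' A)) := hS hη'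
  filter_upwards [Metric.tendsto_nhds.1 h1 (ε / 3) (by positivity)] with t ht
  have h2 : ∀ B, ‖B‖ ≤ ‖A‖ → dist (η B) (η' B) ≤ ε / 3 := by
    intro B hB
    rw [dist_eq_norm, ← _root_.sub_apply]
    rw [dist_eq_norm] at hd
    calc ‖(η - η') B‖ ≤ ‖η - η'‖ * ‖B‖ := (η - η').le_opNorm B
      _ ≤ ε / (3 * (‖A‖ + 1)) * (‖A‖ + 1) := by gcongr; linarith
      _ = ε / 3 := by field_simp
  calc dist (η (Ecut K t * A * Ecut K t)) (η A)
      ≤ dist (η (Ecut K t * A * Ecut K t)) (η' (Ecut K t * A * Ecut K t))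
        + dist (η' (Ecut K t * A * Ecut K t)) (η' A) + dist (η' A) (η A) := dist_triangle4 _ _ _ _
    _ < ε / 3 + ε / 3 + ε / 3 := by
      have := h2 _ (hb t)
      have h3 := h2 A le_rfl
      rw [dist_comm] at h3
      linarith
    _ = ε := by ring

/-- E(t,∞) commutes with (I − Λ)^{1/2}, so cutting `T` amounts to cutting the operator that
represents it, on which the weight is a normal functional. -/
lemma tendsto_cut (μ : BoundaryWeight K) (T : bdAlg K) :
    Tendsto (fun t => μ.1 (cut t T)) (𝓝[>] 0) (𝓝 (μ.1 T)) := by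
  obtain ⟨ℓ, hℓ, h⟩ := μ.2
  obtain ⟨_, A, rfl⟩ := T
  have h1 := tendsto_predual_Ecut hℓ A
  rw [h] at h1
  refine h1.congr' ?_
  filter_upwards [self_mem_nhdsWithin] with t ht
  rw [h]
  congr 1
  apply Subtype.ext
  rw [coe_cut ht]
  change rootOp K * (Ecut K t * A * Ecut K t) * rootOp K = Ecut K t * (rootOp K * A * rootOp K) * Ecut K t
  simp only [← mul_assoc]
  rw [Ecut_mul_rootOp]
  simp only [mul_assoc]
  rw [Ecut_mul_rootOp]

lemma cut_nonneg {t : ℝ} (ht : 0 < t) {A : HS K →L[ℂ] HS K} (hA : 0 ≤ A) :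
    0 ≤ (cut t A : HS K →L[ℂ] HS K) := by
  rw [coe_cut ht]
  exact (Ecut_isSelfAdjoint t).conjugate_nonneg hA

lemma IsPos.cut_nonneg {μ : BoundaryWeight K} (hμ : IsPos μ) {t : ℝ} (ht : 0 < t)
    {A : HS K →L[ℂ] HS K} (hA : 0 ≤ A) : 0 ≤ μ.1 (cut t A) :=
  hμ _ (CPFlow.cut_nonneg ht hA)

lemma IsPos.cut_mono {μ : BoundaryWeight K} (hμ : IsPos μ) {t : ℝ} (ht : 0 < t)
    {A B : HS K →L[ℂ] HS K} (h : A ≤ B) : μ.1 (cut t A) ≤ μ.1 (cut t B) := by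
  have := hμ.cut_nonneg ht (sub_nonneg.2 h)
  rwa [map_sub, map_sub, sub_nonneg] at this

/-- When `B` commutes with the cuts, B − E_s B E_s = (1 − E_s) B (1 − E_s) is positive. Thus
lowering the cut from `s` to `t` adds a positive piece, which drives every monotonicity in `t`
below. -/
lemma exists_cut_eq_sub {s t : ℝ} (ht : 0 < t) (hts : t ≤ s) {B : HS K →L[ℂ] HS K} (hB : 0 ≤ B)
    (hcomm : ∀ r, Ecut K r * B = B * Ecut K r) :
    ∃ A : HS K →L[ℂ] HS K, 0 ≤ A ∧ cut t A = cut t B - cut s B := by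
  refine ⟨B - Ecut K s * B * Ecut K s, ?_, ?_⟩
  · have h : B - Ecut K s * B * Ecut K s = (1 - Ecut K s) * B * (1 - Ecut K s) := by
      simp only [sub_mul, mul_sub, one_mul, mul_one]
      simp only [hcomm, mul_assoc, Ecut_mul_Ecut, max_self]
      abel
    rw [h]
    exact ((IsSelfAdjoint.one _).sub (Ecut_isSelfAdjoint s)).conjugate_nonneg hB
  · rw [map_sub]
    congr 1
    apply Subtype.ext
    rw [coe_cut ht, coe_cut (ht.trans_le hts)]
    have h1 : Ecut K t * Ecut K s = Ecut K s := by rw [Ecut_mul_Ecut, max_eq_right hts]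
    have h2 : Ecut K s * Ecut K t = Ecut K s := by rw [Ecut_mul_Ecut, max_eq_left hts]
    simp only [mul_assoc, h2]
    rw [← mul_assoc, h1]

lemma IsPos.cut_antitone {μ : BoundaryWeight K} (hμ : IsPos μ) {s t : ℝ} (ht : 0 < t) (hts : t ≤ s)
    {B : HS K →L[ℂ] HS K} (hB : 0 ≤ B) (hcomm : ∀ r, Ecut K r * B = B * Ecut K r) :
    μ.1 (cut s B) ≤ μ.1 (cut t B) := by
  obtain ⟨A, hA, h⟩ := exists_cut_eq_sub ht hts hB hcomm
  have := hμ.cut_nonneg ht hA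
  rwa [h, map_sub, sub_nonneg] at this

lemma one_sub_Lam_nonneg {C : K →L[ℂ] K} (hC : C ≤ 1) : 0 ≤ 1 - Lam C := by
  have h1 : 0 ≤ (1 : HS K →L[ℂ] HS K) - Lam (1 : K →L[ℂ] K) := by
    rw [← rootFn_sq]
    have hpos : 0 ≤ mulOp K rootFn memLp_rootFn :=
      mulOp_nonneg _ fun x => Complex.zero_le_real.2 (Real.sqrt_nonneg _)
    simpa using (IsSelfAdjoint.of_nonneg hpos).conjugate_nonneg zero_le_one
  have h2 := Lam_nonneg (sub_nonneg.2 hC)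
  rw [map_sub] at h2
  have := add_nonneg h1 h2
  simpa using this

lemma Ecut_mul_one_sub_Lam (C : K →L[ℂ] K) (r : ℝ) :
    Ecut K r * (1 - Lam C) = (1 - Lam C) * Ecut K r := by
  rw [mul_sub, sub_mul, Ecut_mul_Lam, mul_one, one_mul]

lemma tendsto_of_antitoneOn_of_isLUB {f : ℝ → ℝ} (hf : AntitoneOn f (Ioi 0)) {a : ℝ}
    (ha : IsLUB (f '' Ioi 0) a) : Tendsto f (𝓝[>] 0) (𝓝 a) := by
  refine tendsto_order.2 ⟨fun b hb => ?_, fun b hb => ?_⟩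
  · obtain ⟨_, ⟨s, hs, rfl⟩, hbs⟩ := (lt_isLUB_iff ha).1 hb
    filter_upwards [Ioo_mem_nhdsGT hs] with t ht
    exact hbs.trans_le (hf ht.1 hs ht.2.le)
  · filter_upwards [self_mem_nhdsWithin] with t ht
    exact (ha.1 ⟨t, ht, rfl⟩).trans_lt hb

end Cut

/-! ### Consequences of the square condition on e₁, e₂ -/

section SquarePair

variable {E : Type*} [NormedAddCommGroup E] [InnerProductSpace ℂ E] [CompleteSpace E]

lemma inner_eq_ofReal_of_nonneg {T : E →L[ℂ] E} (hT : 0 ≤ T) (f : E) :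
    inner ℂ f (T f) = ((inner ℂ f (T f)).re : ℂ) := by
  have := (Complex.nonneg_iff.1 (nonneg_iff_inner.1 hT f)).2
  apply Complex.ext <;> simp [← this]

/-- Two positive operators with `e₁ + e₂ ≤ I` such that vector states can make either expectation
arbitrarily close to `1`. -/
structure IsSquarePair (e₁ e₂ : E →L[ℂ] E) : Prop where
  nonneg₁ : 0 ≤ e₁
  nonneg₂ : 0 ≤ e₂
  add_le : e₁ + e₂ ≤ 1
  exists₁ : ∀ ε : ℝ, 0 < ε → ∃ f : E, ‖f‖ = 1 ∧ 1 - ε ≤ (inner ℂ f (e₁ f)).re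
  exists₂ : ∀ ε : ℝ, 0 < ε → ∃ f : E, ‖f‖ = 1 ∧ 1 - ε ≤ (inner ℂ f (e₂ f)).re

variable {e₁ e₂ : E →L[ℂ] E}

lemma IsSquarePair.symm (h : IsSquarePair e₁ e₂) : IsSquarePair e₂ e₁ :=
  ⟨h.nonneg₂, h.nonneg₁, by rw [add_comm]; exact h.add_le, h.exists₂, h.exists₁⟩

/-- If all unit vectors had expectation below 1 − ε, then (1 + ε)e ≤ I, because (1 + ε)(1 − ε) ≤ 1.
-/
lemma exists_unit_of_not_smul_le_one {e : E →L[ℂ] E} (he : 0 ≤ e)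
    (h : ∀ c : ℝ, 1 < c → ¬ (c : ℂ) • e ≤ 1) {ε : ℝ} (hε : 0 < ε) :
    ∃ f : E, ‖f‖ = 1 ∧ 1 - ε ≤ (inner ℂ f (e f)).re := by
  by_contra! hcon
  refine h (1 + ε) (by linarith) ?_
  rw [← sub_nonneg, nonneg_iff_inner]
  intro f
  have h1 : inner ℂ f ((1 - ((1 + ε : ℝ) : ℂ) • e) f)
      = ((‖f‖ ^ 2 - (1 + ε) * (inner ℂ f (e f)).re : ℝ) : ℂ) := by
    rw [_root_.sub_apply, _root_.one_apply_eq_self, _root_.smul_apply, inner_sub_right,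
      inner_smul_right, inner_self_eq_norm_sq_to_K, inner_eq_ofReal_of_nonneg he f]
    push_cast
    simp
  rw [h1, Complex.zero_le_real]
  rcases eq_or_ne f 0 with rfl | hf
  · simp
  have hf' : 0 < ‖f‖ := norm_pos_iff.2 hf
  have h2 := hcon ((‖f‖⁻¹ : ℂ) • f) (by simp [norm_smul, hf'.ne'])
  have h3 : (inner ℂ ((‖f‖⁻¹ : ℂ) • f) (e ((‖f‖⁻¹ : ℂ) • f))).re
      = ‖f‖⁻¹ ^ 2 * (inner ℂ f (e f)).re := by
    rw [map_smul, inner_smul_left, inner_smul_right, inner_eq_ofReal_of_nonneg he f,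
      ← Complex.ofReal_inv, Complex.conj_ofReal, ← Complex.ofReal_mul, ← Complex.ofReal_mul,
      Complex.ofReal_re, Complex.ofReal_re]
    ring
  rw [h3, inv_pow, inv_mul_lt_iff₀ (by positivity)] at h2
  have h4 : 0 ≤ (inner ℂ f (e f)).re := (Complex.nonneg_iff.1 (nonneg_iff_inner.1 he f)).1
  nlinarith [sq_nonneg ‖f‖, mul_nonneg (sq_nonneg ε) (sq_nonneg ‖f‖)]

/-- Only the corner (1,1) and the points (c,0), (0,c) with c > 1 are tested. -/
lemma isSquarePair_of_iff (he₁ : 0 ≤ e₁) (he₂ : 0 ≤ e₂)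
    (hsq : ∀ x₁ x₂ : ℝ,
      (0 ≤ (x₁ : ℂ) • e₁ + (x₂ : ℂ) • e₂ ∧ (x₁ : ℂ) • e₁ + (x₂ : ℂ) • e₂ ≤ 1) ↔
        (x₁ ∈ Set.Icc (0 : ℝ) 1 ∧ x₂ ∈ Set.Icc (0 : ℝ) 1)) : IsSquarePair e₁ e₂ := by
  have hs : ∀ {e : E →L[ℂ] E} {c : ℝ}, 0 ≤ e → 1 < c → 0 ≤ (c : ℂ) • e := fun he hc =>
    nonneg_iff_inner.2 fun f => by
      rw [_root_.smul_apply, inner_smul_right]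
      exact mul_nonneg (Complex.zero_le_real.2 (by linarith)) (nonneg_iff_inner.1 he f)
  refine ⟨he₁, he₂, ?_, fun ε hε => ?_, fun ε hε => ?_⟩
  · simpa using ((hsq 1 1).2 (by simp)).2
  · refine exists_unit_of_not_smul_le_one he₁ (fun c hc hle => ?_) hε
    have := (hsq c 0).1 (by simpa using ⟨hs he₁ hc, hle⟩)
    exact absurd this.1.2 (not_le.2 hc)
  · refine exists_unit_of_not_smul_le_one he₂ (fun c hc hle => ?_) hε
    have := (hsq 0 c).1 (by simpa using ⟨hs he₂ hc, hle⟩)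
    exact absurd this.2.2 (not_le.2 hc)

/-- An affine inequality in the expectations of `e₁` and `e₂` persists at the point `(1,0)`. -/
lemma IsSquarePair.nonneg_of_forall (h : IsSquarePair e₁ e₂) {c₀ c₁ c₂ : ℝ}
    (hc : ∀ f : E, ‖f‖ = 1 →
      0 ≤ c₀ + c₁ * (inner ℂ f (e₁ f)).re + c₂ * (inner ℂ f (e₂ f)).re) : 0 ≤ c₀ + c₁ := by
  by_contra! hneg
  -- With ⟨e₁⟩ within ε of 1, `e₁ + e₂ ≤ 1` forces ⟨e₂⟩ ≤ ε. The total error (|c₁| + |c₂|)ε is then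
  -- less than half of the supposed deficit −(c₀ + c₁) plus nothing else, a contradiction.
  obtain ⟨f, hf, hp⟩ := h.exists₁ (-(c₀ + c₁) / (2 * (|c₁| + |c₂| + 1)))
    (div_pos (by linarith) (by positivity))
  set ε := -(c₀ + c₁) / (2 * (|c₁| + |c₂| + 1)) with hε
  have hεeq : ε * (2 * (|c₁| + |c₂| + 1)) = -(c₀ + c₁) := div_mul_cancel₀ _ (by positivity)
  have hεpos : 0 < ε := div_pos (by linarith) (by positivity)
  have hc' := hc f hf
  have hq : 0 ≤ (inner ℂ f (e₂ f)).re := (Complex.nonneg_iff.1 (nonneg_iff_inner.1 h.nonneg₂ f)).1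
  have hpq : (inner ℂ f (e₁ f)).re + (inner ℂ f (e₂ f)).re ≤ 1 := by
    have h1 := (Complex.nonneg_iff.1 (nonneg_iff_inner.1 (sub_nonneg.2 h.add_le) f)).1
    rw [_root_.sub_apply, _root_.one_apply_eq_self, _root_.add_apply, inner_sub_right,
      inner_add_right, inner_self_eq_norm_sq_to_K, hf] at h1
    simp at h1
    linarith
  set p := (inner ℂ f (e₁ f)).re
  set q := (inner ℂ f (e₂ f)).re
  have h1 : c₁ * (p - 1) ≤ |c₁| * ε := by
    refine (le_abs_self _).trans ?_
    rw [abs_mul]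
    gcongr
    rw [abs_le]
    constructor <;> linarith
  have h2 : c₂ * q ≤ |c₂| * ε := by
    refine (le_abs_self _).trans ?_
    rw [abs_mul]
    gcongr
    rw [abs_le]
    constructor <;> linarith
  nlinarith

lemma norm_inner_apply_le_of_nonneg {e : E →L[ℂ] E} (he : 0 ≤ e) (f g : E) :
    ‖inner ℂ f (e g)‖ ^ 2 ≤ (inner ℂ f (e f)).re * (inner ℂ g (e g)).re := by
  obtain ⟨b, rfl⟩ := CStarAlgebra.nonneg_iff_eq_star_mul_self.1 he
  have h : ∀ f g : E, inner ℂ f ((star b * b) g) = inner ℂ (b f) (b g) := fun f g =>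
    ContinuousLinearMap.adjoint_inner_right b f (b g)
  rw [h, h, h]
  have h1 : ∀ f : E, (inner ℂ (b f) (b f)).re = ‖b f‖ ^ 2 := fun f =>
    inner_self_eq_norm_sq (𝕜 := ℂ) (b f)
  rw [h1, h1, ← mul_pow]
  gcongr
  exact norm_inner_le_norm _ _

/-- Cauchy–Schwarz for each form ⟨f, eᵢ g⟩, followed by the arithmetic–geometric mean inequality,
reduces the bound to ⟨f,(e₁+e₂)f⟩ ≤ ‖f‖². This is the dual form of contractivity. -/
lemma IsSquarePair.norm_le (h : IsSquarePair e₁ e₂) {z₁ z₂ : ℂ} {r : ℝ}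
    (h₁ : ‖z₁‖ ≤ r) (h₂ : ‖z₂‖ ≤ r) : ‖z₁ • e₁ + z₂ • e₂‖ ≤ r := by
  have hr : 0 ≤ r := (norm_nonneg _).trans h₁
  have hle : ∀ f : E, (inner ℂ f (e₁ f)).re + (inner ℂ f (e₂ f)).re ≤ ‖f‖ ^ 2 := by
    intro f
    have h1 := (Complex.nonneg_iff.1 (nonneg_iff_inner.1 (sub_nonneg.2 h.add_le) f)).1
    rw [_root_.sub_apply, _root_.one_apply_eq_self, _root_.add_apply, inner_sub_right,
      inner_add_right, Complex.sub_re, Complex.add_re] at h1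
    have h2 : (inner ℂ f f).re = ‖f‖ ^ 2 := inner_self_eq_norm_sq (𝕜 := ℂ) f
    linarith
  have h0 : ∀ {e : E →L[ℂ] E}, 0 ≤ e → ∀ f, 0 ≤ (inner ℂ f (e f)).re := fun he f =>
    (Complex.nonneg_iff.1 (nonneg_iff_inner.1 he f)).1
  have hab : ∀ {e : E →L[ℂ] E}, 0 ≤ e → ∀ f g,
      ‖inner ℂ f (e g)‖ ≤ ((inner ℂ f (e f)).re + (inner ℂ g (e g)).re) / 2 := by
    intro e he f g
    refine abs_le_of_sq_le_sq' ?_ (by linarith [h0 he f, h0 he g]) |>.2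
    nlinarith [norm_inner_apply_le_of_nonneg he f g,
      sq_nonneg ((inner ℂ f (e f)).re - (inner ℂ g (e g)).re)]
  refine ContinuousLinearMap.opNorm_le_of_re_inner_le hr fun g f hg hf => ?_
  refine (Complex.re_le_norm _).trans ?_
  rw [norm_inner_symm, _root_.add_apply, _root_.smul_apply, _root_.smul_apply, inner_add_right,
    inner_smul_right, inner_smul_right]
  refine (norm_add_le _ _).trans ?_
  rw [norm_mul, norm_mul]
  have hf2 : ‖f‖ ^ 2 ≤ 1 := by nlinarith [norm_nonneg f]
  have hg2 : ‖g‖ ^ 2 ≤ 1 := by nlinarith [norm_nonneg g]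
  calc ‖z₁‖ * ‖inner ℂ f (e₁ g)‖ + ‖z₂‖ * ‖inner ℂ f (e₂ g)‖
      ≤ r * (((inner ℂ f (e₁ f)).re + (inner ℂ g (e₁ g)).re) / 2)
        + r * (((inner ℂ f (e₂ f)).re + (inner ℂ g (e₂ g)).re) / 2) := by
        gcongr
        · exact hab h.nonneg₁ f g
        · exact hab h.nonneg₂ f g
    _ = r * (((inner ℂ f (e₁ f)).re + (inner ℂ f (e₂ f)).re
          + ((inner ℂ g (e₁ g)).re + (inner ℂ g (e₂ g)).re)) / 2) := by ring
    _ ≤ r * 1 := by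
        gcongr
        linarith [hle f, hle g]
    _ = r := mul_one r

end SquarePair

/-! ### Cramer's rule for I + Λ̂ω|_t -/

section Truncations

variable {K : Type*} [NormedAddCommGroup K] [InnerProductSpace ℂ K] [CompleteSpace K]

/-- The real part of `μ(A|_t)`. -/
def truncRe (μ : BoundaryWeight K) (t : ℝ) (A : HS K →L[ℂ] HS K) : ℝ := (μ.1 (cut t A)).re

lemma truncRe_add (μ : BoundaryWeight K) (t : ℝ) (A B : HS K →L[ℂ] HS K) :
    truncRe μ t (A + B) = truncRe μ t A + truncRe μ t B := by simp [truncRe]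

lemma truncRe_sub (μ : BoundaryWeight K) (t : ℝ) (A B : HS K →L[ℂ] HS K) :
    truncRe μ t (A - B) = truncRe μ t A - truncRe μ t B := by simp [truncRe]

lemma truncRe_sub_smul (μ ν : BoundaryWeight K) (c t : ℝ) (A : HS K →L[ℂ] HS K) :
    truncRe (μ - (c : ℂ) • ν) t A = truncRe μ t A - c * truncRe ν t A := by simp [truncRe]

lemma IsPos.truncRe_nonneg {μ : BoundaryWeight K} (hμ : IsPos μ) {t : ℝ} (ht : 0 < t)
    {A : HS K →L[ℂ] HS K} (hA : 0 ≤ A) : 0 ≤ truncRe μ t A :=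
  (Complex.nonneg_iff.1 (hμ.cut_nonneg ht hA)).1

lemma IsPos.truncRe_antitone {μ : BoundaryWeight K} (hμ : IsPos μ) {s t : ℝ} (ht : 0 < t)
    (hts : t ≤ s) {B : HS K →L[ℂ] HS K} (hB : 0 ≤ B)
    (hcomm : ∀ r, Ecut K r * B = B * Ecut K r) : truncRe μ s B ≤ truncRe μ t B :=
  (Complex.le_def.1 (hμ.cut_antitone ht hts hB hcomm)).1

lemma IsPos.cut_eq_truncRe {μ : BoundaryWeight K} (hμ : IsPos μ) {t : ℝ} (ht : 0 < t)
    {A : HS K →L[ℂ] HS K} (hA : 0 ≤ A) : μ.1 (cut t A) = (truncRe μ t A : ℂ) := by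
  have := (Complex.nonneg_iff.1 (hμ.cut_nonneg ht hA)).2
  apply Complex.ext <;> simp [truncRe, ← this]

lemma truncRe_one {e₁ e₂ : K →L[ℂ] K} (μ : BoundaryWeight K) (t : ℝ) :
    truncRe μ t 1 = truncRe μ t (1 - Lam (e₁ + e₂)) + truncRe μ t (Lam e₁)
      + truncRe μ t (Lam e₂) := by
  rw [truncRe_sub, map_add, truncRe_add]
  ring

/-- The determinant of the `2 × 2` system that governs `I + Λ̂ ω|_t`. -/
def pairDet (e₁ e₂ : K →L[ℂ] K) (μ₁ μ₂ : BoundaryWeight K) (t : ℝ) : ℝ :=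
  (1 + truncRe μ₁ t (Lam e₁)) * (1 + truncRe μ₂ t (Lam e₂))
    - truncRe μ₁ t (Lam e₂) * truncRe μ₂ t (Lam e₁)

lemma pairDet_symm (e₁ e₂ : K →L[ℂ] K) (μ₁ μ₂ : BoundaryWeight K) (t : ℝ) :
    pairDet e₁ e₂ μ₁ μ₂ t = pairDet e₂ e₁ μ₂ μ₁ t := by
  unfold pairDet
  ring

/-- The functional `(1 + ν(Λ(e)|_t)) μ|_t - μ(Λ(e)|_t) ν|_t`. -/
def pairNum (μ ν : BoundaryWeight K) (e : K →L[ℂ] K) (t : ℝ) : (HS K →L[ℂ] HS K) →ₗ[ℂ] ℂ :=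
  (1 + truncRe ν t (Lam e) : ℂ) • (μ.1 ∘ₗ cut t) - (truncRe μ t (Lam e) : ℂ) • (ν.1 ∘ₗ cut t)

lemma pairNum_apply (μ ν : BoundaryWeight K) (e : K →L[ℂ] K) (t : ℝ) (B : HS K →L[ℂ] HS K) :
    pairNum μ ν e t B = (1 + truncRe ν t (Lam e)) * μ.1 (cut t B)
      - truncRe μ t (Lam e) * ν.1 (cut t B) := rfl

lemma pairNum_re (μ ν : BoundaryWeight K) (e : K →L[ℂ] K) (t : ℝ) (B : HS K →L[ℂ] HS K) :
    (pairNum μ ν e t B).re = (1 + truncRe ν t (Lam e)) * truncRe μ t B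
      - truncRe μ t (Lam e) * truncRe ν t B := by
  simp [pairNum_apply, truncRe]

lemma pairNum_eq_ofReal {μ ν : BoundaryWeight K} (hμ : IsPos μ) (hν : IsPos ν) (e : K →L[ℂ] K)
    {t : ℝ} (ht : 0 < t) {B : HS K →L[ℂ] HS K} (hB : 0 ≤ B) :
    pairNum μ ν e t B = ((pairNum μ ν e t B).re : ℂ) := by
  rw [pairNum_re, pairNum_apply, hμ.cut_eq_truncRe ht hB, hν.cut_eq_truncRe ht hB]
  push_cast
  rfl

/-- Turns positivity of `pairNum` into the comparison μ|_t ≥ h(t) ν|_t, the prefactor being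
positive. -/
lemma pairNum_re_eq {μ ν : BoundaryWeight K} (hν : IsPos ν) {e : K →L[ℂ] K} (he : 0 ≤ e) {t : ℝ}
    (ht : 0 < t) (B : HS K →L[ℂ] HS K) :
    (pairNum μ ν e t B).re = (1 + truncRe ν t (Lam e))
      * (truncRe μ t B - hFun μ ν e t * truncRe ν t B) := by
  have h : 0 < 1 + truncRe ν t (Lam e) := by
    have := hν.truncRe_nonneg ht (Lam_nonneg he)
    linarith
  have h1 : hFun μ ν e t * (1 + truncRe ν t (Lam e)) = truncRe μ t (Lam e) :=
    div_mul_cancel₀ _ h.ne'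
  rw [pairNum_re, ← h1]
  ring

variable {e₁ e₂ : K →L[ℂ] K} {μ₁ μ₂ : BoundaryWeight K} {ω : Predual K →ₗ[ℂ] BoundaryWeight K}
  {t : ℝ}

lemma trunc_comp_apply (hω : ∀ ρ, ω ρ = ρ.1 e₁ • μ₁ + ρ.1 e₂ • μ₂) (ρ : Predual K)
    (B : HS K →L[ℂ] HS K) : (trunc t (ω ρ)).1 B
      = ρ.1 e₁ * μ₁.1 (cut t B) + ρ.1 e₂ * μ₂.1 (cut t B) := by
  rw [trunc_apply, hω]
  rfl

lemma onePlus_apply (hω : ∀ ρ, ω ρ = ρ.1 e₁ • μ₁ + ρ.1 e₂ • μ₂) (ρ : Predual K) (B : K →L[ℂ] K) :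
    (onePlus ω t ρ).1 B
      = ρ.1 B + (ρ.1 e₁ * μ₁.1 (cut t (Lam B)) + ρ.1 e₂ * μ₂.1 (cut t (Lam B))) := by
  rw [← trunc_comp_apply hω]
  rfl

/-- Cramer's rule for (ρ(e₁), ρ(e₂)), where σ = (I + Λ̂ω|_t)ρ. The determinant stays on the left so
that the identity is available before its sign is known. -/
lemma piHat_apply (h : IsSquarePair e₁ e₂) (hμ₁ : IsPos μ₁) (hμ₂ : IsPos μ₂)
    (hω : ∀ ρ, ω ρ = ρ.1 e₁ • μ₁ + ρ.1 e₂ • μ₂) (ht : 0 < t)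
    (hu : IsUnit (onePlus ω t)) (σ : Predual K) (B : HS K →L[ℂ] HS K) :
    (pairDet e₁ e₂ μ₁ μ₂ t : ℂ) * (piHat ω t σ).1 B
      = σ.1 e₁ * pairNum μ₁ μ₂ e₂ t B + σ.1 e₂ * pairNum μ₂ μ₁ e₁ t B := by
  rw [pairNum_apply, pairNum_apply]
  set ρ := Ring.inverse (onePlus ω t) σ with hρ
  have hσ : σ = onePlus ω t ρ := by
    have := congrArg (fun T : Module.End ℂ (Predual K) => T σ) (Ring.mul_inverse_cancel _ hu)
    exact this.symm
  have h1 : (piHat ω t σ).1 B = ρ.1 e₁ * μ₁.1 (cut t B) + ρ.1 e₂ * μ₂.1 (cut t B) :=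
    trunc_comp_apply hω ρ B
  rw [h1, hσ, onePlus_apply hω, onePlus_apply hω]
  rw [hμ₁.cut_eq_truncRe ht (Lam_nonneg h.nonneg₁), hμ₁.cut_eq_truncRe ht (Lam_nonneg h.nonneg₂),
    hμ₂.cut_eq_truncRe ht (Lam_nonneg h.nonneg₁), hμ₂.cut_eq_truncRe ht (Lam_nonneg h.nonneg₂)]
  unfold pairDet
  push_cast
  ring

/-- Λ̂ω|_t depends on ρ only through (ρ(e₁), ρ(e₂)), so injectivity and surjectivity both reduce to
a `2 × 2` system with determinant `pairDet`. -/
lemma isUnit_onePlus (h : IsSquarePair e₁ e₂) (hμ₁ : IsPos μ₁) (hμ₂ : IsPos μ₂)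
    (hω : ∀ ρ, ω ρ = ρ.1 e₁ • μ₁ + ρ.1 e₂ • μ₂) (ht : 0 < t)
    (hD : pairDet e₁ e₂ μ₁ μ₂ t ≠ 0) : IsUnit (onePlus ω t) := by
  have hD' : (pairDet e₁ e₂ μ₁ μ₂ t : ℂ) ≠ 0 := by exact_mod_cast hD
  rw [Module.End.isUnit_iff]
  have r11 := hμ₁.cut_eq_truncRe ht (Lam_nonneg h.nonneg₁)
  have r12 := hμ₁.cut_eq_truncRe ht (Lam_nonneg h.nonneg₂)
  have r21 := hμ₂.cut_eq_truncRe ht (Lam_nonneg h.nonneg₁)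
  have r22 := hμ₂.cut_eq_truncRe ht (Lam_nonneg h.nonneg₂)
  constructor
  · refine (injective_iff_map_eq_zero _).2 fun ρ hρ => ?_
    have h0 : ∀ B, ρ.1 B + (ρ.1 e₁ * μ₁.1 (cut t (Lam B)) + ρ.1 e₂ * μ₂.1 (cut t (Lam B))) = 0 := by
      intro B
      rw [← onePlus_apply hω, hρ]
      rfl
    have h1 := h0 e₁
    have h2 := h0 e₂
    rw [r11, r21] at h1
    rw [r12, r22] at h2
    have h3 : (pairDet e₁ e₂ μ₁ μ₂ t : ℂ) * ρ.1 e₁ = 0 := by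
      unfold pairDet
      push_cast
      linear_combination (1 + (truncRe μ₂ t (Lam e₂) : ℂ)) * h1 - (truncRe μ₂ t (Lam e₁) : ℂ) * h2
    have h4 : (pairDet e₁ e₂ μ₁ μ₂ t : ℂ) * ρ.1 e₂ = 0 := by
      unfold pairDet
      push_cast
      linear_combination (1 + (truncRe μ₁ t (Lam e₁) : ℂ)) * h2 - (truncRe μ₁ t (Lam e₂) : ℂ) * h1
    have h5 := (mul_eq_zero.1 h3).resolve_left hD'
    have h6 := (mul_eq_zero.1 h4).resolve_left hD'
    apply Subtype.ext
    ext1 B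
    have := h0 B
    rw [h5, h6] at this
    simpa using this
  · intro σ
    -- The values that ρ(e₁) and ρ(e₂) must take, by Cramer's rule. The preimage ρ is then
    -- determined.
    let r₁ : ℂ := ((1 + truncRe μ₂ t (Lam e₂)) * σ.1 e₁ - truncRe μ₂ t (Lam e₁) * σ.1 e₂)
      / pairDet e₁ e₂ μ₁ μ₂ t
    let r₂ : ℂ := ((1 + truncRe μ₁ t (Lam e₁)) * σ.1 e₂ - truncRe μ₁ t (Lam e₂) * σ.1 e₁)
      / pairDet e₁ e₂ μ₁ μ₂ t
    let ρ : Predual K := σ - r₁ • LamHat (trunc t μ₁) - r₂ • LamHat (trunc t μ₂)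
    have hρ : ∀ B, ρ.1 B = σ.1 B - r₁ * μ₁.1 (cut t (Lam B)) - r₂ * μ₂.1 (cut t (Lam B)) := by
      intro B
      rw [← trunc_apply, ← trunc_apply]
      rfl
    have hd₁ : r₁ * pairDet e₁ e₂ μ₁ μ₂ t
        = (1 + truncRe μ₂ t (Lam e₂)) * σ.1 e₁ - truncRe μ₂ t (Lam e₁) * σ.1 e₂ :=
      div_mul_cancel₀ _ hD'
    have hd₂ : r₂ * pairDet e₁ e₂ μ₁ μ₂ t
        = (1 + truncRe μ₁ t (Lam e₁)) * σ.1 e₂ - truncRe μ₁ t (Lam e₂) * σ.1 e₁ :=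
      div_mul_cancel₀ _ hD'
    have hD2 : (pairDet e₁ e₂ μ₁ μ₂ t : ℂ) = (1 + truncRe μ₁ t (Lam e₁)) * (1 + truncRe μ₂ t (Lam e₂))
        - truncRe μ₁ t (Lam e₂) * truncRe μ₂ t (Lam e₁) := by
      unfold pairDet
      push_cast
      rfl
    have h1 : ρ.1 e₁ = r₁ := by
      rw [hρ, r11, r21]
      apply mul_right_cancel₀ hD'
      linear_combination (-(1 + truncRe μ₁ t (Lam e₁)) : ℂ) * hd₁ - (truncRe μ₂ t (Lam e₁) : ℂ) * hd₂
        + σ.1 e₁ * hD2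
    have h2 : ρ.1 e₂ = r₂ := by
      rw [hρ, r12, r22]
      apply mul_right_cancel₀ hD'
      linear_combination (-(1 + truncRe μ₂ t (Lam e₂)) : ℂ) * hd₂ - (truncRe μ₁ t (Lam e₂) : ℂ) * hd₁
        + σ.1 e₂ * hD2
    refine ⟨ρ, ?_⟩
    apply Subtype.ext
    ext1 B
    rw [onePlus_apply hω, h1, h2, hρ]
    ring

end Truncations

/-! ### The parallelogram described by inequalities -/

section Parallelogram

variable {κ₁ κ₂ : ℝ}

/-- In edge coordinates, x − κ₁y = r(1 − κ₁) and y − κ₂x = s(1 − κ₂). If some κᵢ = 1, its strip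
collapses to the line x = y and the unit square cuts out the segment, so including the square treats
both cases at once. -/
lemma mem_parallelogram_iff (h₁ : κ₁ ∈ Icc (0 : ℝ) 1) (h₂ : κ₂ ∈ Icc (0 : ℝ) 1) {x y : ℝ} :
    (x, y) ∈ parallelogram κ₁ κ₂ ↔ (x ∈ Icc (0 : ℝ) 1 ∧ y ∈ Icc (0 : ℝ) 1) ∧
      x - κ₁ * y ∈ Icc (0 : ℝ) (1 - κ₁) ∧ y - κ₂ * x ∈ Icc (0 : ℝ) (1 - κ₂) := by
  obtain ⟨h₁0, h₁1⟩ := h₁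
  obtain ⟨h₂0, h₂1⟩ := h₂
  constructor
  · rintro ⟨a, b, ha, hb, hab, s, ⟨hs0, hs1⟩, r, ⟨hr0, hr1⟩, hp⟩
    simp only [Prod.smul_mk, smul_eq_mul, Prod.mk_add_mk, Prod.mk.injEq, mul_one] at hab hp
    obtain ⟨hab1, hab2⟩ := hab
    obtain ⟨rfl, rfl⟩ := hp
    have e1 : s * (a * κ₁) + r * b - κ₁ * (s * a + r * (b * κ₂)) = r * (1 - κ₁) := by
      linear_combination r * hab1 - κ₁ * r * hab2
    have e2 : s * a + r * (b * κ₂) - κ₂ * (s * (a * κ₁) + r * b) = s * (1 - κ₂) := by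
      linear_combination s * hab2 - κ₂ * s * hab1
    rw [e1, e2]
    have haκ := mul_nonneg ha h₁0
    have hbκ := mul_nonneg hb h₂0
    refine ⟨⟨⟨by positivity, ?_⟩, ⟨by positivity, ?_⟩⟩,
      ⟨mul_nonneg hr0 (by linarith), mul_le_of_le_one_left (by linarith) hr1⟩,
      ⟨mul_nonneg hs0 (by linarith), mul_le_of_le_one_left (by linarith) hs1⟩⟩
    · linarith [mul_le_of_le_one_left haκ hs1, mul_le_of_le_one_left hb hr1]
    · linarith [mul_le_of_le_one_left ha hs1, mul_le_of_le_one_left hbκ hr1]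
  · rintro ⟨⟨⟨hx0, hx1⟩, ⟨hy0, hy1⟩⟩, ⟨hxy0, hxy1⟩, ⟨hyx0, hyx1⟩⟩
    rcases h₁1.eq_or_lt with rfl | h₁lt
    · have hxy : x = y := by linarith
      subst hxy
      -- Degenerate case: a single edge, the whole diagonal.
      exact ⟨1, 0, zero_le_one, le_rfl, by simp, x, ⟨hx0, hx1⟩, 0, by simp, by simp⟩
    rcases h₂1.eq_or_lt with rfl | h₂lt
    · have hxy : x = y := by linarith
      subst hxy
      exact ⟨0, 1, le_rfl, zero_le_one, by simp, 0, by simp, x, ⟨hx0, hx1⟩, by simp⟩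
    have hκ : 0 < 1 - κ₁ * κ₂ := by nlinarith
    have hc₁ : 0 < 1 - κ₁ := by linarith
    have hc₂ : 0 < 1 - κ₂ := by linarith
    -- The solution a, b of a(κ₁,1) + b(1,κ₂) = (1,1), whose determinant is nonzero since κ₁κ₂ < 1.
    obtain ⟨a, ha, ha'⟩ : ∃ a, 0 ≤ a ∧ a * (1 - κ₁ * κ₂) = 1 - κ₂ :=
      ⟨_, div_nonneg hc₂.le hκ.le, div_mul_cancel₀ _ hκ.ne'⟩
    obtain ⟨b, hb, hb'⟩ : ∃ b, 0 ≤ b ∧ b * (1 - κ₁ * κ₂) = 1 - κ₁ :=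
      ⟨_, div_nonneg hc₁.le hκ.le, div_mul_cancel₀ _ hκ.ne'⟩
    obtain ⟨s, hs, hs'⟩ : ∃ s ∈ Icc (0 : ℝ) 1, s * (1 - κ₂) = y - κ₂ * x :=
      ⟨_, ⟨div_nonneg hyx0 hc₂.le, (div_le_one hc₂).2 hyx1⟩, div_mul_cancel₀ _ hc₂.ne'⟩
    obtain ⟨r, hr, hr'⟩ : ∃ r ∈ Icc (0 : ℝ) 1, r * (1 - κ₁) = x - κ₁ * y :=
      ⟨_, ⟨div_nonneg hxy0 hc₁.le, (div_le_one hc₁).2 hxy1⟩, div_mul_cancel₀ _ hc₁.ne'⟩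
    refine ⟨a, b, ha, hb, ?_, s, hs, r, hr, ?_⟩
    · simp only [Prod.smul_mk, smul_eq_mul, Prod.mk_add_mk, Prod.mk.injEq, mul_one]
      constructor <;> apply mul_right_cancel₀ hκ.ne'
      · linear_combination κ₁ * ha' + hb'
      · linear_combination ha' + κ₂ * hb'
    · simp only [Prod.smul_mk, smul_eq_mul, Prod.mk_add_mk, Prod.mk.injEq, mul_one]
      constructor <;> apply mul_right_cancel₀ hκ.ne'
      · linear_combination -(s * κ₁) * ha' - r * hb' - κ₁ * hs' - hr'
      · linear_combination -s * ha' - (r * κ₂) * hb' - hs' - κ₂ * hr'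

lemma parallelogram_eq_segment (h₁ : κ₁ ∈ Icc (0 : ℝ) 1) (h₂ : κ₂ ∈ Icc (0 : ℝ) 1)
    (h : κ₁ = 1 ∨ κ₂ = 1) : parallelogram κ₁ κ₂ = {p | 0 ≤ p.1 ∧ p.1 = p.2 ∧ p.2 ≤ 1} := by
  ext ⟨x, y⟩
  rw [mem_parallelogram_iff h₁ h₂]
  simp only [mem_ofPred_eq, mem_Icc]
  obtain ⟨h₁0, h₁1⟩ := h₁
  obtain ⟨h₂0, h₂1⟩ := h₂
  constructor
  · rintro ⟨⟨⟨hx0, hx1⟩, ⟨hy0, hy1⟩⟩, ⟨hxy0, hxy1⟩, ⟨hyx0, hyx1⟩⟩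
    refine ⟨hx0, ?_, hy1⟩
    rcases h with rfl | rfl <;> linarith
  · rintro ⟨hx0, rfl, hx1⟩
    refine ⟨⟨⟨hx0, hx1⟩, ⟨hx0, hx1⟩⟩, ⟨?_, ?_⟩, ⟨?_, ?_⟩⟩ <;> nlinarith

/-- The square constraints are implied by the strips: (1 − κ₁κ₂)x = (x − κ₁y) + κ₁(y − κ₂x), and
symmetrically for y. -/
lemma parallelogram_eq (h₁ : κ₁ ∈ Icc (0 : ℝ) 1) (h₂ : κ₂ ∈ Icc (0 : ℝ) 1) (h₁' : κ₁ < 1)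
    (h₂' : κ₂ < 1) : parallelogram κ₁ κ₂ =
      {p | (0 ≤ p.1 - κ₁ * p.2 ∧ p.1 - κ₁ * p.2 ≤ 1 - κ₁) ∧
        (0 ≤ p.2 - κ₂ * p.1 ∧ p.2 - κ₂ * p.1 ≤ 1 - κ₂)} := by
  ext ⟨x, y⟩
  rw [mem_parallelogram_iff h₁ h₂]
  simp only [mem_ofPred_eq, mem_Icc]
  refine ⟨fun h => h.2, fun h => ⟨?_, h⟩⟩
  obtain ⟨⟨hxy0, hxy1⟩, ⟨hyx0, hyx1⟩⟩ := h
  obtain ⟨h₁0, -⟩ := h₁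
  obtain ⟨h₂0, -⟩ := h₂
  have hκ : 0 < 1 - κ₁ * κ₂ := by nlinarith
  refine ⟨⟨?_, ?_⟩, ⟨?_, ?_⟩⟩
  · refine le_of_mul_le_mul_left ?_ hκ
    linarith [mul_nonneg h₁0 hyx0]
  · refine le_of_mul_le_mul_left ?_ hκ
    linarith [mul_le_mul_of_nonneg_left hyx1 h₁0]
  · refine le_of_mul_le_mul_left ?_ hκ
    linarith [mul_nonneg h₂0 hxy0]
  · refine le_of_mul_le_mul_left ?_ hκ
    linarith [mul_le_mul_of_nonneg_left hxy1 h₂0]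

end Parallelogram

/-! ### Monotonicity of h, values of weights, and when a weight vanishes -/

section HFun

variable {K : Type*} [NormedAddCommGroup K] [InnerProductSpace ℂ K] [CompleteSpace K]
  {μ ν : BoundaryWeight K}

lemma one_add_truncRe_pos (hν : IsPos ν) {e : K →L[ℂ] K} (he : 0 ≤ e) {t : ℝ} (ht : 0 < t) :
    0 < 1 + truncRe ν t (Lam e) := by
  have := hν.truncRe_nonneg ht (Lam_nonneg he)
  linarith

lemma hFun_mul (hν : IsPos ν) {e : K →L[ℂ] K} (he : 0 ≤ e) {t : ℝ} (ht : 0 < t) :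
    hFun μ ν e t * (1 + truncRe ν t (Lam e)) = truncRe μ t (Lam e) :=
  div_mul_cancel₀ _ (one_add_truncRe_pos hν he ht).ne'

lemma hFun_nonneg (hμ : IsPos μ) (hν : IsPos ν) {e : K →L[ℂ] K} (he : 0 ≤ e) {t : ℝ} (ht : 0 < t) :
    0 ≤ hFun μ ν e t :=
  div_nonneg (hμ.truncRe_nonneg ht (Lam_nonneg he)) (one_add_truncRe_pos hν he ht).le

/-- A mediant argument: from `s` down to `t`, numerator and denominator of h grow by increments with
numerator increment at least `c` times the denominator increment. If `c` is at least the value of h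
at either endpoint, h cannot decrease. -/
lemma antitoneOn_hFun (hν : IsPos ν) {e : K →L[ℂ] K} (he : 0 ≤ e)
    (h : ∀ t s, 0 < t → t ≤ s → ∃ c, (hFun μ ν e t ≤ c ∨ hFun μ ν e s ≤ c) ∧
      ∀ A : HS K →L[ℂ] HS K, 0 ≤ A → c * truncRe ν t A ≤ truncRe μ t A) :
    AntitoneOn (hFun μ ν e) (Ioi 0) := by
  intro t ht s hs hts
  have ht : 0 < t := ht
  have hs : 0 < s := hs
  obtain ⟨c, hc, hle⟩ := h t s ht hts
  obtain ⟨A, hA, hcut⟩ := exists_cut_eq_sub ht hts (Lam_nonneg he) fun r => Ecut_mul_Lam r e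
  have hA1 : ∀ η : BoundaryWeight K,
      truncRe η t A = truncRe η t (Lam e) - truncRe η s (Lam e) := fun η => by
    simp [truncRe, hcut]
  have h1 := hle A hA
  rw [hA1, hA1] at h1
  have hd : 0 ≤ truncRe ν t (Lam e) - truncRe ν s (Lam e) := by
    rw [← hA1]
    exact hν.truncRe_nonneg ht hA
  have e1 := hFun_mul (μ := μ) hν he ht
  have e2 := hFun_mul (μ := μ) hν he hs
  rcases hc with hc | hc
  · refine (div_le_iff₀ (one_add_truncRe_pos hν he hs)).2 ?_
    change truncRe μ s (Lam e) ≤ hFun μ ν e t * (1 + truncRe ν s (Lam e))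
    nlinarith [mul_le_mul_of_nonneg_right hc hd]
  · refine (le_div_iff₀ (one_add_truncRe_pos hν he ht)).2 ?_
    change hFun μ ν e s * (1 + truncRe ν t (Lam e)) ≤ truncRe μ t (Lam e)
    nlinarith [mul_le_mul_of_nonneg_right hc hd]

lemma isPos_sub_smul_of_tendsto (hμ : IsPos μ) (hν : IsPos ν) {h : ℝ → ℝ} {κ : ℝ}
    (hh : Tendsto h (𝓝[>] 0) (𝓝 κ))
    (hle : ∀ t, 0 < t → ∀ A : HS K →L[ℂ] HS K, 0 ≤ A → h t * truncRe ν t A ≤ truncRe μ t A) :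
    IsPos (μ - (κ : ℂ) • ν) := by
  intro T hT
  have h1 : Tendsto (fun t => μ.1 (cut t T) - (h t : ℂ) * ν.1 (cut t T)) (𝓝[>] 0)
      (𝓝 (μ.1 T - (κ : ℂ) * ν.1 T)) :=
    (tendsto_cut μ T).sub (((Complex.continuous_ofReal.tendsto κ).comp hh).mul (tendsto_cut ν T))
  refine ge_of_tendsto h1 ?_
  filter_upwards [self_mem_nhdsWithin] with t ht
  rw [hμ.cut_eq_truncRe ht hT, hν.cut_eq_truncRe ht hT, ← Complex.ofReal_mul, ← Complex.ofReal_sub,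
    Complex.zero_le_real, sub_nonneg]
  exact hle t ht _ hT

lemma IsPos.hasValue_of_isLUB (hμ : IsPos μ) {B : HS K →L[ℂ] HS K} (hB : 0 ≤ B)
    (hcomm : ∀ r, Ecut K r * B = B * Ecut K r) {x : ℝ}
    (hx : IsLUB ((fun t => truncRe μ t B) '' Ioi 0) x) : HasValue μ B x := by
  have h1 := tendsto_of_antitoneOn_of_isLUB
    (fun t ht s _ hts => hμ.truncRe_antitone ht hts hB hcomm) hx
  refine ((Complex.continuous_ofReal.tendsto x).comp h1).congr' ?_
  filter_upwards [self_mem_nhdsWithin] with t ht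
  exact (hμ.cut_eq_truncRe ht hB).symm

lemma HasValue.tendsto_truncRe {B : HS K →L[ℂ] HS K} {x : ℝ} (h : HasValue μ B x) :
    Tendsto (fun t => truncRe μ t B) (𝓝[>] 0) (𝓝 x) :=
  (Complex.continuous_re.tendsto _).comp h

lemma HasValue.truncRe_le (hμ : IsPos μ) {B : HS K →L[ℂ] HS K} (hB : 0 ≤ B)
    (hcomm : ∀ r, Ecut K r * B = B * Ecut K r) {x : ℝ} (h : HasValue μ B x) {t : ℝ} (ht : 0 < t) :
    truncRe μ t B ≤ x := by
  refine ge_of_tendsto h.tendsto_truncRe ?_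
  filter_upwards [Ioo_mem_nhdsGT ht] with s hs
  exact hμ.truncRe_antitone hs.1 hs.2.le hB hcomm

lemma HasValue.sub_smul {B : HS K →L[ℂ] HS K} {x y : ℝ} (hx : HasValue μ B x) (hy : HasValue ν B y)
    (c : ℝ) : HasValue (μ - (c : ℂ) • ν) B (x - c * y) := by
  have := Tendsto.sub hx (Tendsto.const_mul (c : ℂ) hy)
  rw [HasValue]
  push_cast
  exact this

/-- I − Λ ≤ I − Λ(C), and truncations of the larger operator increase to its value. -/
lemma IsPos.apply_oneSubLam_le (hμ : IsPos μ) {C : K →L[ℂ] K} (hC : C ≤ 1) {x : ℝ}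
    (h : HasValue μ (1 - Lam C) x) : μ.1 (oneSubLam K) ≤ x := by
  refine le_of_tendsto (tendsto_cut μ _) ?_
  filter_upwards [self_mem_nhdsWithin] with t ht
  have h1 : (oneSubLam K : HS K →L[ℂ] HS K) ≤ 1 - Lam C := by
    rw [coe_oneSubLam, ← sub_nonneg]
    have := Lam_nonneg (sub_nonneg.2 hC)
    rw [map_sub] at this
    convert this using 1
    abel
  refine (hμ.cut_mono ht h1).trans ?_
  rw [hμ.cut_eq_truncRe ht (one_sub_Lam_nonneg hC), Complex.real_le_real]
  exact h.truncRe_le hμ (one_sub_Lam_nonneg hC) (Ecut_mul_one_sub_Lam C) ht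

lemma rootOp_nonneg : 0 ≤ rootOp K := by
  rw [rootOp_eq]
  exact mulOp_nonneg _ fun x => Complex.zero_le_real.2 (Real.sqrt_nonneg _)

lemma IsPos.apply_oneSubLam_nonneg (hμ : IsPos μ) : 0 ≤ μ.1 (oneSubLam K) := by
  refine hμ _ ?_
  rw [coe_oneSubLam]
  exact one_sub_Lam_nonneg le_rfl

/-- The positive functional on B(𝔥) representing `μ` takes the value μ(I − Λ) at 1, and this value
bounds its norm. -/
lemma IsPos.eq_zero_of_apply_oneSubLam (hμ : IsPos μ) (h : μ.1 (oneSubLam K) = 0) : μ = 0 := by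
  obtain ⟨ℓ, -, hℓ⟩ := μ.2
  have h0 : ∀ A, ℓ A = 0 := by
    intro A
    have h1 := norm_le_of_positive (ℓ : (HS K →L[ℂ] HS K) →ₗ[ℂ] ℂ) (fun B hB => by
      change 0 ≤ ℓ B
      rw [hℓ]
      exact hμ _ ((IsSelfAdjoint.of_nonneg rootOp_nonneg).conjugate_nonneg hB)) A
    have h2 : ℓ 1 = 0 := (hℓ 1).trans h
    change ‖ℓ A‖ ≤ ‖A‖ * (ℓ 1).re at h1
    rw [h2, Complex.zero_re, mul_zero] at h1
    exact norm_le_zero_iff.1 h1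
  apply Subtype.ext
  ext T
  obtain ⟨_, A, rfl⟩ := T
  exact (hℓ A).symm.trans (h0 A)

/-- The rigidity behind κᵢ = 1: the positive weight μ − ν has value 0 on I − Λ(C), hence on the
smaller I − Λ. -/
lemma eq_of_isPos_sub_of_hasValue (h : IsPos (μ - ν)) {C : K →L[ℂ] K} (hC : C ≤ 1) {x : ℝ}
    (hx : HasValue μ (1 - Lam C) x) (hy : HasValue ν (1 - Lam C) x) : μ = ν := by
  refine sub_eq_zero.1 (h.eq_zero_of_apply_oneSubLam (le_antisymm ?_ h.apply_oneSubLam_nonneg))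
  have h1 : HasValue (μ - ν) (1 - Lam C) 0 := by
    simpa using hx.sub_smul hy 1
  simpa using h.apply_oneSubLam_le hC h1

end HFun

/-! ### From q-weight map to the conditions -/

section Pairs

variable {K : Type*} [NormedAddCommGroup K] [InnerProductSpace ℂ K] [CompleteSpace K]
  {e₁ e₂ : K →L[ℂ] K} {μ₁ μ₂ : BoundaryWeight K} {ω : Predual K →ₗ[ℂ] BoundaryWeight K} {t : ℝ}

lemma pairDet_eq (h : IsSquarePair e₁ e₂) (hμ₁ : IsPos μ₁) (hμ₂ : IsPos μ₂) (ht : 0 < t) :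
    pairDet e₁ e₂ μ₁ μ₂ t = (1 + truncRe μ₁ t (Lam e₁)) * (1 + truncRe μ₂ t (Lam e₂))
      * (1 - hFun μ₁ μ₂ e₂ t * hFun μ₂ μ₁ e₁ t) := by
  unfold pairDet
  linear_combination (hFun μ₂ μ₁ e₁ t * (1 + truncRe μ₁ t (Lam e₁)))
    * hFun_mul (μ := μ₁) hμ₂ h.nonneg₂ ht
    + truncRe μ₁ t (Lam e₂) * hFun_mul (μ := μ₂) hμ₁ h.nonneg₁ ht

/-- The contraction condition at the identity, in terms of the values on `I - Λ(e₁ + e₂)`. -/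
lemma pairNum_one_le_pairDet_iff (h : IsSquarePair e₁ e₂) (hμ₂ : IsPos μ₂) (ht : 0 < t) :
    (pairNum μ₁ μ₂ e₂ t 1).re ≤ pairDet e₁ e₂ μ₁ μ₂ t ↔
      truncRe μ₁ t (1 - Lam (e₁ + e₂)) - hFun μ₁ μ₂ e₂ t * truncRe μ₂ t (1 - Lam (e₁ + e₂))
        ≤ 1 - hFun μ₁ μ₂ e₂ t := by
  have hM := one_add_truncRe_pos hμ₂ h.nonneg₂ ht
  -- Splitting 1 as (1 − Λ(e₁+e₂)) + Λ(e₁) + Λ(e₂), the Λ(eᵢ) terms cancel against the determinant.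
  have key : pairDet e₁ e₂ μ₁ μ₂ t - (pairNum μ₁ μ₂ e₂ t 1).re = (1 + truncRe μ₂ t (Lam e₂))
      * ((1 - hFun μ₁ μ₂ e₂ t) - (truncRe μ₁ t (1 - Lam (e₁ + e₂))
        - hFun μ₁ μ₂ e₂ t * truncRe μ₂ t (1 - Lam (e₁ + e₂)))) := by
    rw [pairNum_re_eq hμ₂ h.nonneg₂ ht, truncRe_one (e₁ := e₁) (e₂ := e₂),
      truncRe_one (e₁ := e₁) (e₂ := e₂)]
    unfold pairDet
    linear_combination (truncRe μ₂ t (Lam e₁) + 1 + truncRe μ₂ t (Lam e₂))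
      * hFun_mul (μ := μ₁) hμ₂ h.nonneg₂ ht
  rw [← sub_nonneg, key, mul_nonneg_iff_of_pos_left hM, sub_nonneg]

lemma predualMatPos_vecFun (f : K) :
    PredualMatPos fun _ _ : Fin 1 => (⟨vecFun f f, vecFun_mem f f⟩ : Predual K) := by
  intro T hT
  simpa using hT fun _ => f

/-- If the determinant vanished, surjectivity of I + Λ̂ω|_t would impose a fixed linear relation
between ⟨e₁⟩ and ⟨e₂⟩ in all vector states. It fails near (1,0). -/
lemma IsQWeight.pairDet_ne_zero (h : IsSquarePair e₁ e₂) (hμ₁ : IsPos μ₁) (hμ₂ : IsPos μ₂)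
    (hω : ∀ ρ, ω ρ = ρ.1 e₁ • μ₁ + ρ.1 e₂ • μ₂) (hq : IsQWeight ω) (ht : 0 < t) :
    pairDet e₁ e₂ μ₁ μ₂ t ≠ 0 := by
  intro hD
  have hN : ∀ f : K, (1 + truncRe μ₂ t (Lam e₂)) * (inner ℂ f (e₁ f)).re
      - truncRe μ₂ t (Lam e₁) * (inner ℂ f (e₂ f)).re = 0 := by
    intro f
    obtain ⟨ρ, hρ⟩ := ((Module.End.isUnit_iff _).1 (hq.invertible t ht)).2 ⟨vecFun f f, vecFun_mem f f⟩
    have h1 : ∀ B : K →L[ℂ] K, inner ℂ f (B f)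
        = ρ.1 B + (ρ.1 e₁ * μ₁.1 (cut t (Lam B)) + ρ.1 e₂ * μ₂.1 (cut t (Lam B))) := fun B => by
      rw [← onePlus_apply hω, hρ]
      rfl
    have h2 := h1 e₁
    have h3 := h1 e₂
    rw [hμ₁.cut_eq_truncRe ht (Lam_nonneg h.nonneg₁), hμ₂.cut_eq_truncRe ht (Lam_nonneg h.nonneg₁),
      inner_eq_ofReal_of_nonneg h.nonneg₁] at h2
    rw [hμ₁.cut_eq_truncRe ht (Lam_nonneg h.nonneg₂), hμ₂.cut_eq_truncRe ht (Lam_nonneg h.nonneg₂),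
      inner_eq_ofReal_of_nonneg h.nonneg₂] at h3
    have h4 := congrArg Complex.ofReal hD
    unfold pairDet at h4
    push_cast at h4
    have h5 : (((1 + truncRe μ₂ t (Lam e₂)) * (inner ℂ f (e₁ f)).re
        - truncRe μ₂ t (Lam e₁) * (inner ℂ f (e₂ f)).re : ℝ) : ℂ) = 0 := by
      push_cast
      linear_combination (1 + (truncRe μ₂ t (Lam e₂) : ℂ)) * h2 - (truncRe μ₂ t (Lam e₁) : ℂ) * h3
        + ρ.1 e₁ * h4
    exact_mod_cast h5
  have h1 := h.nonneg_of_forall (c₀ := 0) (c₁ := -(1 + truncRe μ₂ t (Lam e₂)))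
    (c₂ := truncRe μ₂ t (Lam e₁)) fun f _ => by linarith [hN f]
  linarith [one_add_truncRe_pos hμ₂ h.nonneg₂ ht]

/-- `π̂_t` on vector states, on positive operators. -/
lemma IsQWeight.pairDet_mul_piHat (h : IsSquarePair e₁ e₂) (hμ₁ : IsPos μ₁) (hμ₂ : IsPos μ₂)
    (hω : ∀ ρ, ω ρ = ρ.1 e₁ • μ₁ + ρ.1 e₂ • μ₂) (hq : IsQWeight ω) (ht : 0 < t) (f : K)
    {A : HS K →L[ℂ] HS K} (hA : 0 ≤ A) : ∃ z : ℝ, 0 ≤ z ∧ z ≤ ‖f‖ * ‖f‖ * ‖A‖ ∧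
      pairDet e₁ e₂ μ₁ μ₂ t * z = (inner ℂ f (e₁ f)).re * (pairNum μ₁ μ₂ e₂ t A).re
        + (inner ℂ f (e₂ f)).re * (pairNum μ₂ μ₁ e₁ t A).re := by
  let σ : Predual K := ⟨vecFun f f, vecFun_mem f f⟩
  have hpos : 0 ≤ (piHat ω t σ).1 A := by
    have := hq.piHat_cp t ht 1 _ (predualMatPos_vecFun f) (fun _ _ => A) fun g => by
      simpa using nonneg_iff_inner.1 hA (g 0)
    simpa using this
  obtain ⟨h0, h1⟩ := Complex.nonneg_iff.1 hpos
  have h2 : (piHat ω t σ).1 A = (((piHat ω t σ).1 A).re : ℂ) := by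
    apply Complex.ext <;> simp [← h1]
  refine ⟨((piHat ω t σ).1 A).re, h0, ?_, ?_⟩
  · refine (Complex.re_le_norm _).trans (((piHat ω t σ).1.le_opNorm A).trans ?_)
    gcongr
    exact (hq.piHat_contraction t ht σ).trans (norm_vecFun_le f f)
  · have h3 := piHat_apply h hμ₁ hμ₂ hω ht (hq.invertible t ht) σ A
    change _ = inner ℂ f (e₁ f) * _ + inner ℂ f (e₂ f) * _ at h3
    rw [h2, pairNum_eq_ofReal hμ₁ hμ₂ _ ht hA, pairNum_eq_ofReal hμ₂ hμ₁ _ ht hA,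
      inner_eq_ofReal_of_nonneg h.nonneg₁, inner_eq_ofReal_of_nonneg h.nonneg₂] at h3
    exact_mod_cast h3

/-- Vector states near (1,0) isolate the first numerator. The extra factor `pairDet` makes the
argument independent of its sign, which is settled afterwards. -/
lemma IsQWeight.pairDet_mul_pairNum_nonneg (h : IsSquarePair e₁ e₂) (hμ₁ : IsPos μ₁)
    (hμ₂ : IsPos μ₂) (hω : ∀ ρ, ω ρ = ρ.1 e₁ • μ₁ + ρ.1 e₂ • μ₂) (hq : IsQWeight ω) (ht : 0 < t)
    {A : HS K →L[ℂ] HS K} (hA : 0 ≤ A) :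
    0 ≤ pairDet e₁ e₂ μ₁ μ₂ t * (pairNum μ₁ μ₂ e₂ t A).re := by
  rw [← zero_add (_ * _)]
  refine h.nonneg_of_forall (c₂ := pairDet e₁ e₂ μ₁ μ₂ t * (pairNum μ₂ μ₁ e₁ t A).re) fun f _ => ?_
  obtain ⟨z, hz, -, hD⟩ := hq.pairDet_mul_piHat h hμ₁ hμ₂ hω ht f hA
  have : 0 ≤ pairDet e₁ e₂ μ₁ μ₂ t * (pairDet e₁ e₂ μ₁ μ₂ t * z) := by
    rw [← mul_assoc]
    exact mul_nonneg (mul_self_nonneg _) hz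
  rw [hD] at this
  linarith

lemma IsQWeight.pairDet_pos (h : IsSquarePair e₁ e₂) (hμ₁ : IsPos μ₁) (hμ₂ : IsPos μ₂)
    (hω : ∀ ρ, ω ρ = ρ.1 e₁ • μ₁ + ρ.1 e₂ • μ₂) (hq : IsQWeight ω) (ht : 0 < t) :
    0 < pairDet e₁ e₂ μ₁ μ₂ t := by
  refine (hq.pairDet_ne_zero h hμ₁ hμ₂ hω ht).lt_or_gt.resolve_left fun hneg => ?_
  -- At Λ(e₂) the numerator equals μ₁(Λ(e₂)|_t) ≥ 0. A negative determinant would force this to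
  -- vanish, leaving a product of positive factors as determinant.
  have h1 := hq.pairDet_mul_pairNum_nonneg h hμ₁ hμ₂ hω ht (Lam_nonneg h.nonneg₂)
  have h2 : (pairNum μ₁ μ₂ e₂ t (Lam e₂)).re = truncRe μ₁ t (Lam e₂) := by
    rw [pairNum_re]
    ring
  have h3 := hμ₁.truncRe_nonneg ht (Lam_nonneg h.nonneg₂)
  rw [h2] at h1
  have h4 : truncRe μ₁ t (Lam e₂) = 0 := by nlinarith
  have h5 := mul_pos (one_add_truncRe_pos hμ₁ h.nonneg₁ ht) (one_add_truncRe_pos hμ₂ h.nonneg₂ ht)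
  unfold pairDet at hneg
  rw [h4, zero_mul, sub_zero] at hneg
  linarith

lemma IsQWeight.hFun_mul_le (h : IsSquarePair e₁ e₂) (hμ₁ : IsPos μ₁) (hμ₂ : IsPos μ₂)
    (hω : ∀ ρ, ω ρ = ρ.1 e₁ • μ₁ + ρ.1 e₂ • μ₂) (hq : IsQWeight ω) (ht : 0 < t)
    {A : HS K →L[ℂ] HS K} (hA : 0 ≤ A) :
    hFun μ₁ μ₂ e₂ t * truncRe μ₂ t A ≤ truncRe μ₁ t A := by
  have h1 := hq.pairDet_mul_pairNum_nonneg h hμ₁ hμ₂ hω ht hA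
  have h2 := nonneg_of_mul_nonneg_right h1 (hq.pairDet_pos h hμ₁ hμ₂ hω ht)
  rw [pairNum_re_eq hμ₂ h.nonneg₂ ht] at h2
  exact sub_nonneg.1 (nonneg_of_mul_nonneg_right h2 (one_add_truncRe_pos hμ₂ h.nonneg₂ ht))

/-- Contractivity tested at the identity, in vector states near (1,0). -/
lemma IsQWeight.truncRe_sub_le (h : IsSquarePair e₁ e₂) (hμ₁ : IsPos μ₁) (hμ₂ : IsPos μ₂)
    (hω : ∀ ρ, ω ρ = ρ.1 e₁ • μ₁ + ρ.1 e₂ • μ₂) (hq : IsQWeight ω) (ht : 0 < t) :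
    truncRe μ₁ t (1 - Lam (e₁ + e₂)) - hFun μ₁ μ₂ e₂ t * truncRe μ₂ t (1 - Lam (e₁ + e₂))
        ≤ 1 - hFun μ₁ μ₂ e₂ t := by
  rw [← pairNum_one_le_pairDet_iff h hμ₂ ht, ← sub_nonneg, sub_eq_add_neg]
  refine h.nonneg_of_forall (c₂ := -(pairNum μ₂ μ₁ e₁ t 1).re) fun f hf => ?_
  obtain ⟨z, -, hz, hD⟩ := hq.pairDet_mul_piHat h hμ₁ hμ₂ hω ht f zero_le_one
  rw [hf, one_mul, one_mul] at hz
  have hz1 : z ≤ 1 := hz.trans ContinuousLinearMap.norm_id_le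
  have := mul_le_of_le_one_right (hq.pairDet_pos h hμ₁ hμ₂ hω ht).le hz1
  linarith

/-- The quantity (μ₁ − h₁μ₂)((I − Λ(e₁+e₂))|_t) lies between 0 and 1 − h₁. -/
lemma IsQWeight.hFun_le_one (h : IsSquarePair e₁ e₂) (hμ₁ : IsPos μ₁) (hμ₂ : IsPos μ₂)
    (hω : ∀ ρ, ω ρ = ρ.1 e₁ • μ₁ + ρ.1 e₂ • μ₂) (hq : IsQWeight ω) (ht : 0 < t) :
    hFun μ₁ μ₂ e₂ t ≤ 1 := by
  linarith [hq.truncRe_sub_le h hμ₁ hμ₂ hω ht,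
    hq.hFun_mul_le h hμ₁ hμ₂ hω ht (one_sub_Lam_nonneg h.add_le)]

lemma IsQWeight.antitoneOn_hFun (h : IsSquarePair e₁ e₂) (hμ₁ : IsPos μ₁) (hμ₂ : IsPos μ₂)
    (hω : ∀ ρ, ω ρ = ρ.1 e₁ • μ₁ + ρ.1 e₂ • μ₂) (hq : IsQWeight ω) :
    AntitoneOn (hFun μ₁ μ₂ e₂) (Ioi 0) :=
  CPFlow.antitoneOn_hFun hμ₂ h.nonneg₂ fun _ _ ht _ =>
    ⟨_, Or.inl le_rfl, fun _ hA => hq.hFun_mul_le h hμ₁ hμ₂ hω ht hA⟩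

/-- With x, y the truncated values, x ≤ 1 − h₁ + h₁y and y ≤ 1 − h₂ + h₂x give (1 − h₁h₂)x ≤ 1 −
h₁h₂, and 1 − h₁h₂ > 0 because the determinant is positive. -/
lemma IsQWeight.truncRe_le_one (h : IsSquarePair e₁ e₂) (hμ₁ : IsPos μ₁) (hμ₂ : IsPos μ₂)
    (hω : ∀ ρ, ω ρ = ρ.1 e₁ • μ₁ + ρ.1 e₂ • μ₂) (hq : IsQWeight ω) (ht : 0 < t) :
    truncRe μ₁ t (1 - Lam (e₁ + e₂)) ≤ 1 := by
  have hω' : ∀ ρ, ω ρ = ρ.1 e₂ • μ₂ + ρ.1 e₁ • μ₁ := fun ρ => by rw [hω, add_comm]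
  have h1 := hq.truncRe_sub_le h hμ₁ hμ₂ hω ht
  have h2 := hq.truncRe_sub_le h.symm hμ₂ hμ₁ hω' ht
  rw [add_comm e₂ e₁] at h2
  have h3 := hq.pairDet_pos h hμ₁ hμ₂ hω ht
  rw [pairDet_eq h hμ₁ hμ₂ ht] at h3
  have h4 := pos_of_mul_pos_right h3 (mul_pos (one_add_truncRe_pos hμ₁ h.nonneg₁ ht)
    (one_add_truncRe_pos hμ₂ h.nonneg₂ ht)).le
  have h5 := mul_le_mul_of_nonneg_left h2 (hFun_nonneg (e := e₂) hμ₁ hμ₂ h.nonneg₂ ht)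
  refine le_of_mul_le_mul_left ?_ h4
  linarith

lemma IsQWeight.isLUB_hFun (h : IsSquarePair e₁ e₂) (hμ₁ : IsPos μ₁) (hμ₂ : IsPos μ₂)
    (hω : ∀ ρ, ω ρ = ρ.1 e₁ • μ₁ + ρ.1 e₂ • μ₂) (hq : IsQWeight ω) :
    ∃ κ, IsLUB (hFun μ₁ μ₂ e₂ '' Ioi 0) κ ∧ κ ∈ Icc (0 : ℝ) 1 ∧
      Tendsto (hFun μ₁ μ₂ e₂) (𝓝[>] 0) (𝓝 κ) ∧ IsPos (μ₁ - (κ : ℂ) • μ₂) := by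
  have hne : (hFun μ₁ μ₂ e₂ '' Ioi 0).Nonempty := nonempty_Ioi.image _
  have hub : ∀ y ∈ hFun μ₁ μ₂ e₂ '' Ioi 0, y ≤ 1 := by
    rintro _ ⟨t, ht, rfl⟩
    exact hq.hFun_le_one h hμ₁ hμ₂ hω ht
  have hlub := isLUB_csSup hne ⟨1, hub⟩
  have hlim := tendsto_of_antitoneOn_of_isLUB (hq.antitoneOn_hFun h hμ₁ hμ₂ hω) hlub
  refine ⟨_, hlub, ⟨?_, csSup_le hne hub⟩, hlim, isPos_sub_smul_of_tendsto hμ₁ hμ₂ hlim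
    fun t ht A hA => hq.hFun_mul_le h hμ₁ hμ₂ hω ht hA⟩
  exact (hFun_nonneg hμ₁ hμ₂ h.nonneg₂ one_pos).trans (hlub.1 ⟨1, mem_Ioi.2 one_pos, rfl⟩)

lemma IsQWeight.exists_hasValue (h : IsSquarePair e₁ e₂) (hμ₁ : IsPos μ₁) (hμ₂ : IsPos μ₂)
    (hω : ∀ ρ, ω ρ = ρ.1 e₁ • μ₁ + ρ.1 e₂ • μ₂) (hq : IsQWeight ω) :
    ∃ x ∈ Icc (0 : ℝ) 1, HasValue μ₁ (1 - Lam (e₁ + e₂)) x := by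
  have hne : ((fun t => truncRe μ₁ t (1 - Lam (e₁ + e₂))) '' Ioi 0).Nonempty := nonempty_Ioi.image _
  have hub : ∀ y ∈ (fun t => truncRe μ₁ t (1 - Lam (e₁ + e₂))) '' Ioi 0, y ≤ 1 := by
    rintro _ ⟨t, ht, rfl⟩
    exact hq.truncRe_le_one h hμ₁ hμ₂ hω ht
  have hlub := isLUB_csSup hne ⟨1, hub⟩
  refine ⟨_, ⟨?_, csSup_le hne hub⟩, hμ₁.hasValue_of_isLUB (one_sub_Lam_nonneg h.add_le)
    (Ecut_mul_one_sub_Lam _) hlub⟩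
  exact (hμ₁.truncRe_nonneg one_pos (one_sub_Lam_nonneg h.add_le)).trans (hlub.1 ⟨1, mem_Ioi.2 one_pos, rfl⟩)

lemma IsQWeight.sub_mem_Icc (h : IsSquarePair e₁ e₂) (hμ₁ : IsPos μ₁) (hμ₂ : IsPos μ₂)
    (hω : ∀ ρ, ω ρ = ρ.1 e₁ • μ₁ + ρ.1 e₂ • μ₂) (hq : IsQWeight ω) {κ x y : ℝ}
    (hκ : Tendsto (hFun μ₁ μ₂ e₂) (𝓝[>] 0) (𝓝 κ)) (hx : HasValue μ₁ (1 - Lam (e₁ + e₂)) x)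
    (hy : HasValue μ₂ (1 - Lam (e₁ + e₂)) y) : x - κ * y ∈ Icc (0 : ℝ) (1 - κ) := by
  have h1 := hx.tendsto_truncRe.sub (hκ.mul hy.tendsto_truncRe)
  refine ⟨ge_of_tendsto h1 ?_, le_of_tendsto_of_tendsto h1 (hκ.const_sub 1) ?_⟩
  · filter_upwards [self_mem_nhdsWithin] with t ht
    exact sub_nonneg.2 (hq.hFun_mul_le h hμ₁ hμ₂ hω ht (one_sub_Lam_nonneg h.add_le))
  · filter_upwards [self_mem_nhdsWithin] with t ht
    exact hq.truncRe_sub_le h hμ₁ hμ₂ hω ht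

theorem IsQWeight.rankTwoConditions (h : IsSquarePair e₁ e₂) (hμ₁ : IsPos μ₁) (hμ₂ : IsPos μ₂)
    (hω : ∀ ρ, ω ρ = ρ.1 e₁ • μ₁ + ρ.1 e₂ • μ₂) (hq : IsQWeight ω) :
    ∃ κ₁ κ₂ : ℝ, RankTwoConditions e₁ e₂ μ₁ μ₂ κ₁ κ₂ := by
  have hω' : ∀ ρ, ω ρ = ρ.1 e₂ • μ₂ + ρ.1 e₁ • μ₁ := fun ρ => by rw [hω, add_comm]
  obtain ⟨κ₁, hs₁, hm₁, hl₁, hp₁⟩ := hq.isLUB_hFun h hμ₁ hμ₂ hω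
  obtain ⟨κ₂, hs₂, hm₂, hl₂, hp₂⟩ := hq.isLUB_hFun h.symm hμ₂ hμ₁ hω'
  obtain ⟨x, hx01, hx⟩ := hq.exists_hasValue h hμ₁ hμ₂ hω
  obtain ⟨y, hy01, hy⟩ := hq.exists_hasValue h.symm hμ₂ hμ₁ hω'
  have hxy := hq.sub_mem_Icc h.symm hμ₂ hμ₁ hω' hl₂ hy (by rwa [add_comm])
  rw [add_comm e₂ e₁] at hy
  exact ⟨κ₁, κ₂, hs₁, hs₂, hm₁, hm₂, hp₁, hp₂, x, y, hx, hy, (mem_parallelogram_iff hm₁ hm₂).2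
    ⟨⟨hx01, hy01⟩, hq.sub_mem_Icc h hμ₁ hμ₂ hω hl₁ hx hy, hxy⟩⟩

end Pairs

/-! ### From the conditions to a q-weight map -/

section Conditions

variable {K : Type*} [NormedAddCommGroup K] [InnerProductSpace ℂ K] [CompleteSpace K]
  {e₁ e₂ : K →L[ℂ] K} {μ₁ μ₂ : BoundaryWeight K} {ω : Predual K →ₗ[ℂ] BoundaryWeight K}
  {κ₁ κ₂ t : ℝ}

namespace RankTwoConditions

lemma symm (c : RankTwoConditions e₁ e₂ μ₁ μ₂ κ₁ κ₂) : RankTwoConditions e₂ e₁ μ₂ μ₁ κ₂ κ₁ := by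
  obtain ⟨x, y, hx, hy, hxy⟩ := c.normalized
  rw [mem_parallelogram_iff c.mem₁ c.mem₂] at hxy
  refine ⟨c.sup₂, c.sup₁, c.mem₂, c.mem₁, c.ge₂, c.ge₁, y, x, by rwa [add_comm], by rwa [add_comm],
    (mem_parallelogram_iff c.mem₂ c.mem₁).2 ⟨hxy.1.symm, hxy.2.symm⟩⟩

lemma hFun_le (c : RankTwoConditions e₁ e₂ μ₁ μ₂ κ₁ κ₂) (ht : 0 < t) : hFun μ₁ μ₂ e₂ t ≤ κ₁ :=
  c.sup₁.1 ⟨t, ht, rfl⟩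

lemma antitoneOn (h : IsSquarePair e₁ e₂) (hμ₂ : IsPos μ₂)
    (c : RankTwoConditions e₁ e₂ μ₁ μ₂ κ₁ κ₂) : AntitoneOn (hFun μ₁ μ₂ e₂) (Ioi 0) :=
  antitoneOn_hFun hμ₂ h.nonneg₂ fun _ _ ht _ => ⟨κ₁, Or.inl (c.hFun_le ht), fun A hA => by
    have := c.ge₁.truncRe_nonneg ht hA
    rwa [truncRe_sub_smul, sub_nonneg] at this⟩

lemma tendsto (h : IsSquarePair e₁ e₂) (hμ₂ : IsPos μ₂)
    (c : RankTwoConditions e₁ e₂ μ₁ μ₂ κ₁ κ₂) : Tendsto (hFun μ₁ μ₂ e₂) (𝓝[>] 0) (𝓝 κ₁) :=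
  tendsto_of_antitoneOn_of_isLUB (c.antitoneOn h hμ₂) c.sup₁

/-- μ₁ − h₁(t)μ₂ = (μ₁ − κ₁μ₂) + (κ₁ − h₁(t))μ₂, a sum of positive weights. -/
lemma isPos_sub_hFun (hμ₂ : IsPos μ₂) (c : RankTwoConditions e₁ e₂ μ₁ μ₂ κ₁ κ₂) (ht : 0 < t) :
    IsPos (μ₁ - (hFun μ₁ μ₂ e₂ t : ℂ) • μ₂) := by
  intro T hT
  have h1 := c.ge₁ T hT
  have h2 := mul_nonneg (Complex.zero_le_real.2 (sub_nonneg.2 (c.hFun_le ht))) (hμ₂ T hT)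
  convert add_nonneg h1 h2 using 1
  change μ₁.1 T - (hFun μ₁ μ₂ e₂ t : ℂ) * μ₂.1 T = μ₁.1 T - (κ₁ : ℂ) * μ₂.1 T + _
  push_cast
  ring

lemma eq_of_left (h : IsSquarePair e₁ e₂) (c : RankTwoConditions e₁ e₂ μ₁ μ₂ κ₁ κ₂) (hκ : κ₁ = 1) :
    μ₁ = μ₂ := by
  obtain ⟨x, y, hx, hy, hxy⟩ := c.normalized
  rw [parallelogram_eq_segment c.mem₁ c.mem₂ (Or.inl hκ)] at hxy
  obtain ⟨-, rfl : x = y, -⟩ := hxy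
  have hp := c.ge₁
  rw [hκ, Complex.ofReal_one, one_smul] at hp
  exact eq_of_isPos_sub_of_hasValue hp h.add_le hx hy

lemma eq_of_or (h : IsSquarePair e₁ e₂) (c : RankTwoConditions e₁ e₂ μ₁ μ₂ κ₁ κ₂)
    (hκ : κ₁ = 1 ∨ κ₂ = 1) : μ₁ = μ₂ :=
  hκ.elim (c.eq_of_left h) fun hκ => (c.symm.eq_of_left h.symm hκ).symm

lemma pairDet_pos (h : IsSquarePair e₁ e₂) (hμ₁ : IsPos μ₁) (hμ₂ : IsPos μ₂)
    (c : RankTwoConditions e₁ e₂ μ₁ μ₂ κ₁ κ₂) (ht : 0 < t) : 0 < pairDet e₁ e₂ μ₁ μ₂ t := by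
  -- If some κᵢ = 1, the bounds hᵢ ≤ κᵢ alone do not exclude h₁h₂ = 1. There the weights coincide
  -- and the determinant is 1 plus nonnegative terms.
  by_cases hκ : κ₁ = 1 ∨ κ₂ = 1
  · obtain rfl := c.eq_of_or h hκ
    have h1 := hμ₁.truncRe_nonneg ht (Lam_nonneg h.nonneg₁)
    have h2 := hμ₁.truncRe_nonneg ht (Lam_nonneg h.nonneg₂)
    unfold pairDet
    nlinarith
  · rw [pairDet_eq h hμ₁ hμ₂ ht]
    refine mul_pos (mul_pos (one_add_truncRe_pos hμ₁ h.nonneg₁ ht)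
      (one_add_truncRe_pos hμ₂ h.nonneg₂ ht)) (sub_pos.2 ?_)
    rw [not_or] at hκ
    have h1 := (c.hFun_le ht).trans_lt (c.mem₁.2.lt_of_ne hκ.1)
    have h2 := (c.symm.hFun_le ht).trans_lt (c.mem₂.2.lt_of_ne hκ.2)
    exact mul_lt_one_of_nonneg_of_lt_one_left (hFun_nonneg hμ₁ hμ₂ h.nonneg₂ ht) h1 h2.le

lemma pairNum_nonneg (h : IsSquarePair e₁ e₂) (hμ₁ : IsPos μ₁) (hμ₂ : IsPos μ₂)
    (c : RankTwoConditions e₁ e₂ μ₁ μ₂ κ₁ κ₂) (ht : 0 < t) {A : HS K →L[ℂ] HS K} (hA : 0 ≤ A) :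
    0 ≤ pairNum μ₁ μ₂ e₂ t A := by
  rw [pairNum_eq_ofReal hμ₁ hμ₂ _ ht hA, Complex.zero_le_real, pairNum_re_eq hμ₂ h.nonneg₂ ht]
  refine mul_nonneg (one_add_truncRe_pos hμ₂ h.nonneg₂ ht).le ?_
  have := (c.isPos_sub_hFun hμ₂ ht).truncRe_nonneg ht hA
  rwa [truncRe_sub_smul] at this

lemma pairNum_one_le (h : IsSquarePair e₁ e₂) (hμ₂ : IsPos μ₂)
    (c : RankTwoConditions e₁ e₂ μ₁ μ₂ κ₁ κ₂) (ht : 0 < t) :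
    (pairNum μ₁ μ₂ e₂ t 1).re ≤ pairDet e₁ e₂ μ₁ μ₂ t := by
  rw [pairNum_one_le_pairDet_iff h hμ₂ ht, ← truncRe_sub_smul]
  obtain ⟨x, y, hx, hy, hxy⟩ := c.normalized
  obtain ⟨⟨-, -, hy1⟩, ⟨-, hle⟩, -⟩ := (mem_parallelogram_iff c.mem₁ c.mem₂).1 hxy
  have h1 := (hx.sub_smul hy (hFun μ₁ μ₂ e₂ t)).truncRe_le (c.isPos_sub_hFun hμ₂ ht)
    (one_sub_Lam_nonneg h.add_le) (Ecut_mul_one_sub_Lam _) ht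
  -- x − hy = (x − κ₁y) + (κ₁ − h)y ≤ (1 − κ₁) + (κ₁ − h), using y ≤ 1.
  nlinarith [mul_nonneg (sub_nonneg.2 (c.hFun_le ht)) (sub_nonneg.2 hy1)]

lemma norm_pairNum_le (h : IsSquarePair e₁ e₂) (hμ₁ : IsPos μ₁) (hμ₂ : IsPos μ₂)
    (c : RankTwoConditions e₁ e₂ μ₁ μ₂ κ₁ κ₂) (ht : 0 < t) (A : HS K →L[ℂ] HS K) :
    ‖pairNum μ₁ μ₂ e₂ t A‖ ≤ pairDet e₁ e₂ μ₁ μ₂ t * ‖A‖ := by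
  rw [mul_comm]
  refine (norm_le_of_positive _ (fun B hB => c.pairNum_nonneg h hμ₁ hμ₂ ht hB) A).trans ?_
  gcongr
  exact c.pairNum_one_le h hμ₂ ht

lemma apply_oneSubLam_le_one (h : IsSquarePair e₁ e₂) (hμ₁ : IsPos μ₁)
    (c : RankTwoConditions e₁ e₂ μ₁ μ₂ κ₁ κ₂) : μ₁.1 (oneSubLam K) ≤ 1 := by
  obtain ⟨x, y, hx, hy, hxy⟩ := c.normalized
  obtain ⟨⟨⟨-, hx1⟩, -⟩, -⟩ := (mem_parallelogram_iff c.mem₁ c.mem₂).1 hxy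
  refine (hμ₁.apply_oneSubLam_le h.add_le hx).trans ?_
  exact_mod_cast hx1

end RankTwoConditions

lemma sum_mul_apply_nonneg_of_matPos {E : Type*} [NormedAddCommGroup E] [InnerProductSpace ℂ E]
    [CompleteSpace E] (m : (E →L[ℂ] E) →ₗ[ℂ] ℂ) (hm : ∀ T, 0 ≤ T → 0 ≤ m T) {n : ℕ}
    {C : Matrix (Fin n) (Fin n) ℂ} (hC : C.PosSemidef) (T : Fin n → Fin n → E →L[ℂ] E)
    (hT : MatPos T) : 0 ≤ ∑ i, ∑ j, C i j * m (T i j) := by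
  obtain ⟨ι, hι⟩ : ∃ ι : (E →L[ℂ] E) →ₗ[ℂ] (E →L[ℂ] E), ∀ S, ι S = S := ⟨LinearMap.id, fun _ => rfl⟩
  refine sum_mul_nonneg_of_posSemidef ι m (fun S hS => hm S (hι S ▸ hS)) hC T ?_
  simp only [hι]
  exact hT

lemma isCPWeightMap_of_isPos (h : IsSquarePair e₁ e₂) (hμ₁ : IsPos μ₁) (hμ₂ : IsPos μ₂)
    (hω : ∀ ρ, ω ρ = ρ.1 e₁ • μ₁ + ρ.1 e₂ • μ₂) : IsCPWeightMap ω := by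
  intro n ρ hρ T hT
  have h1 := sum_mul_nonneg_of_posSemidef (bdAlg K).subtype μ₁.1 (fun S hS => hμ₁ S hS)
    (hρ.posSemidef h.nonneg₁) T hT
  have h2 := sum_mul_nonneg_of_posSemidef (bdAlg K).subtype μ₂.1 (fun S hS => hμ₂ S hS)
    (hρ.posSemidef h.nonneg₂) T hT
  convert add_nonneg h1 h2 using 1
  simp only [← Finset.sum_add_distrib]
  refine Finset.sum_congr rfl fun i _ => Finset.sum_congr rfl fun j _ => ?_
  rw [hω]
  rfl

lemma RankTwoConditions.isCPPredualMap_piHat (h : IsSquarePair e₁ e₂) (hμ₁ : IsPos μ₁)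
    (hμ₂ : IsPos μ₂) (hω : ∀ ρ, ω ρ = ρ.1 e₁ • μ₁ + ρ.1 e₂ • μ₂)
    (c : RankTwoConditions e₁ e₂ μ₁ μ₂ κ₁ κ₂) (ht : 0 < t) (hu : IsUnit (onePlus ω t)) :
    IsCPPredualMap (piHat ω t) := by
  intro n ρ hρ T hT
  have hD := c.pairDet_pos h hμ₁ hμ₂ ht
  have h1 := sum_mul_apply_nonneg_of_matPos (pairNum μ₁ μ₂ e₂ t)
    (fun S hS => c.pairNum_nonneg h hμ₁ hμ₂ ht hS) (hρ.posSemidef h.nonneg₁) T hT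
  have h2 := sum_mul_apply_nonneg_of_matPos (pairNum μ₂ μ₁ e₁ t)
    (fun S hS => c.symm.pairNum_nonneg h.symm hμ₂ hμ₁ ht hS) (hρ.posSemidef h.nonneg₂) T hT
  refine le_of_mul_le_mul_left ?_ (Complex.zero_lt_real.2 hD)
  rw [mul_zero]
  convert add_nonneg h1 h2 using 1
  simp only [← Finset.sum_add_distrib, Finset.mul_sum]
  refine Finset.sum_congr rfl fun i _ => Finset.sum_congr rfl fun j _ => ?_
  rw [piHat_apply h hμ₁ hμ₂ hω ht hu, Matrix.of_apply, Matrix.of_apply]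

lemma RankTwoConditions.norm_piHat_le (h : IsSquarePair e₁ e₂) (hμ₁ : IsPos μ₁)
    (hμ₂ : IsPos μ₂) (hω : ∀ ρ, ω ρ = ρ.1 e₁ • μ₁ + ρ.1 e₂ • μ₂)
    (c : RankTwoConditions e₁ e₂ μ₁ μ₂ κ₁ κ₂) (ht : 0 < t) (hu : IsUnit (onePlus ω t))
    (σ : Predual K) : ‖piHat ω t σ‖ ≤ ‖σ‖ := by
  have hD := c.pairDet_pos h hμ₁ hμ₂ ht
  change ‖(piHat ω t σ).1‖ ≤ ‖σ.1‖
  refine ContinuousLinearMap.opNorm_le_bound _ (norm_nonneg _) fun B => ?_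
  refine le_of_mul_le_mul_left ?_ hD
  -- Passing to the dual map replaces the norm of π̂_t(σ) by that of an operator combination of e₁
  -- and e₂.
  have h1 : pairDet e₁ e₂ μ₁ μ₂ t * ‖(piHat ω t σ).1 B‖
      = ‖σ.1 (pairNum μ₁ μ₂ e₂ t B • e₁ + pairNum μ₂ μ₁ e₁ t B • e₂)‖ := by
    rw [map_add, map_smul, map_smul, smul_eq_mul, smul_eq_mul, mul_comm (pairNum _ _ _ _ _),
      mul_comm (pairNum _ _ _ _ _), ← piHat_apply h hμ₁ hμ₂ hω ht hu, norm_mul,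
      Complex.norm_real, Real.norm_of_nonneg hD.le]
  have h2 := c.symm.norm_pairNum_le h.symm hμ₂ hμ₁ ht B
  rw [← pairDet_symm] at h2
  have h3 := σ.1.le_opNorm_of_le (h.norm_le (c.norm_pairNum_le h hμ₁ hμ₂ ht B) h2)
  rw [← h1] at h3
  exact h3.trans_eq (mul_left_comm _ _ _)

theorem RankTwoConditions.isQWeight (h : IsSquarePair e₁ e₂) (hμ₁ : IsPos μ₁) (hμ₂ : IsPos μ₂)
    (hω : ∀ ρ, ω ρ = ρ.1 e₁ • μ₁ + ρ.1 e₂ • μ₂) (c : RankTwoConditions e₁ e₂ μ₁ μ₂ κ₁ κ₂) :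
    IsQWeight ω := by
  have hu : ∀ t, 0 < t → IsUnit (onePlus ω t) := fun t ht =>
    isUnit_onePlus h hμ₁ hμ₂ hω ht (c.pairDet_pos h hμ₁ hμ₂ ht).ne'
  refine ⟨isCPWeightMap_of_isPos h hμ₁ hμ₂ hω, fun ρ hρ => ?_, hu,
    fun t ht => c.isCPPredualMap_piHat h hμ₁ hμ₂ hω ht (hu t ht),
    fun t ht => c.norm_piHat_le h hμ₁ hμ₂ hω ht (hu t ht)⟩
  rw [hω]
  change ρ.1 e₁ * μ₁.1 (oneSubLam K) + ρ.1 e₂ * μ₂.1 (oneSubLam K) ≤ ρ.1 1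
  have h1 := mul_le_of_le_one_right (hρ _ h.nonneg₁) (c.apply_oneSubLam_le_one h hμ₁)
  have h2 := mul_le_of_le_one_right (hρ _ h.nonneg₂) (c.symm.apply_oneSubLam_le_one h.symm hμ₂)
  refine (add_le_add h1 h2).trans ?_
  have h3 := hρ _ (sub_nonneg.2 h.add_le)
  rwa [map_sub, map_add, sub_nonneg] at h3

lemma hasRangeRank_one (hω : ∀ ρ, ω ρ = ρ.1 e₁ • μ₁ + ρ.1 e₂ • μ₁) (he : e₁ + e₂ ≠ 0)
    (hμ : μ₁ ≠ 0) : HasRangeRank ω 1 := by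
  refine ⟨μ₁.1.smulRight (e₁ + e₂), fun ρ T => ?_, ?_⟩
  · rw [hω, LinearMap.smulRight_apply, map_smul, map_add]
    change μ₁.1 T * (ρ.1 e₁ + ρ.1 e₂) = ρ.1 e₁ * μ₁.1 T + ρ.1 e₂ * μ₁.1 T
    ring
  · have h0 : μ₁.1 ≠ 0 := fun h => hμ (Subtype.ext h)
    rw [LinearMap.range_smulRight_apply h0, Nat.cast_one, Module.rank_eq_one_iff_finrank_eq_one]
    exact finrank_span_singleton he

lemma hFun_eq_zero (hμ₁ : μ₁ = 0) (e : K →L[ℂ] K) : hFun μ₁ μ₂ e t = 0 := by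
  subst hμ₁
  simp [hFun]

lemma IsSquarePair.add_ne_zero (h : IsSquarePair e₁ e₂) : e₁ + e₂ ≠ 0 := by
  intro h0
  have h1 : 0 ≤ -e₁ := by
    rw [eq_neg_of_add_eq_zero_right h0 |>.symm]
    exact h.nonneg₂
  have h2 : e₁ = 0 := le_antisymm (neg_nonneg.1 h1) h.nonneg₁
  obtain ⟨f, -, hf⟩ := h.exists₁ (1 / 2) (by norm_num)
  rw [h2] at hf
  norm_num at hf

lemma RankTwoConditions.hasRangeRank_one (h : IsSquarePair e₁ e₂)
    (hω : ∀ ρ, ω ρ = ρ.1 e₁ • μ₁ + ρ.1 e₂ • μ₂) (c : RankTwoConditions e₁ e₂ μ₁ μ₂ κ₁ κ₂)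
    (hκ : κ₁ = 1 ∨ κ₂ = 1) : HasRangeRank ω 1 := by
  obtain rfl := c.eq_of_or h hκ
  refine CPFlow.hasRangeRank_one hω h.add_ne_zero fun h0 => ?_
  -- A zero weight would make both h functions vanish, contradicting κᵢ = 1.
  have h1 : κ₁ ≤ 0 := c.sup₁.2 (by rintro _ ⟨t, -, rfl⟩; exact (hFun_eq_zero h0 e₂).le)
  have h2 : κ₂ ≤ 0 := c.sup₂.2 (by rintro _ ⟨t, -, rfl⟩; exact (hFun_eq_zero h0 e₁).le)
  rcases hκ with rfl | rfl <;> linarith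

end Conditions

end CPFlow

end

theorem mainTheorem8 {K : Type*} [NormedAddCommGroup K] [InnerProductSpace ℂ K]
    [CompleteSpace K] [TopologicalSpace.SeparableSpace K]
    (e₁ e₂ : K →L[ℂ] K) (he₁ : 0 ≤ e₁) (he₂ : 0 ≤ e₂)
    (hsq : ∀ x₁ x₂ : ℝ,
      (0 ≤ (x₁ : ℂ) • e₁ + (x₂ : ℂ) • e₂ ∧ (x₁ : ℂ) • e₁ + (x₂ : ℂ) • e₂ ≤ 1) ↔
        (x₁ ∈ Set.Icc (0 : ℝ) 1 ∧ x₂ ∈ Set.Icc (0 : ℝ) 1))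
    (μ₁ μ₂ : CPFlow.BoundaryWeight K) (hμ₁ : CPFlow.IsPos μ₁) (hμ₂ : CPFlow.IsPos μ₂)
    (ω : CPFlow.Predual K →ₗ[ℂ] CPFlow.BoundaryWeight K)
    (hω : ∀ ρ, ω ρ = ρ.1 e₁ • μ₁ + ρ.1 e₂ • μ₂) :
    (CPFlow.IsQWeight ω ↔ ∃ κ₁ κ₂ : ℝ, CPFlow.RankTwoConditions e₁ e₂ μ₁ μ₂ κ₁ κ₂) ∧
    (∀ κ₁ ∈ Set.Icc (0 : ℝ) 1, ∀ κ₂ ∈ Set.Icc (0 : ℝ) 1,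
      ((κ₁ = 1 ∨ κ₂ = 1) →
        CPFlow.parallelogram κ₁ κ₂ = {p | 0 ≤ p.1 ∧ p.1 = p.2 ∧ p.2 ≤ 1}) ∧
      (κ₁ < 1 → κ₂ < 1 →
        CPFlow.parallelogram κ₁ κ₂ =
          {p | (0 ≤ p.1 - κ₁ * p.2 ∧ p.1 - κ₁ * p.2 ≤ 1 - κ₁) ∧
            (0 ≤ p.2 - κ₂ * p.1 ∧ p.2 - κ₂ * p.1 ≤ 1 - κ₂)})) ∧
    (∀ κ₁ κ₂ : ℝ, CPFlow.RankTwoConditions e₁ e₂ μ₁ μ₂ κ₁ κ₂ →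
      AntitoneOn (CPFlow.hFun μ₁ μ₂ e₂) (Set.Ioi 0) ∧
      AntitoneOn (CPFlow.hFun μ₂ μ₁ e₁) (Set.Ioi 0) ∧
      Tendsto (CPFlow.hFun μ₁ μ₂ e₂) (𝓝[>] 0) (𝓝 κ₁) ∧
      Tendsto (CPFlow.hFun μ₂ μ₁ e₁) (𝓝[>] 0) (𝓝 κ₂) ∧
      ((κ₁ = 1 ∨ κ₂ = 1) →
        μ₁ = μ₂ ∧ CPFlow.IsQWeight ω ∧ CPFlow.HasRangeRank ω 1)) := by
  have h := CPFlow.isSquarePair_of_iff he₁ he₂ hsq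
  refine ⟨⟨fun hq => hq.rankTwoConditions h hμ₁ hμ₂ hω,
    fun ⟨_, _, c⟩ => c.isQWeight h hμ₁ hμ₂ hω⟩, fun κ₁ h₁ κ₂ h₂ =>
    ⟨CPFlow.parallelogram_eq_segment h₁ h₂, CPFlow.parallelogram_eq h₁ h₂⟩, fun κ₁ κ₂ c => ?_⟩
  exact ⟨c.antitoneOn h hμ₂, c.symm.antitoneOn h.symm hμ₁, c.tendsto h hμ₂,
    c.symm.tendsto h.symm hμ₁, fun hκ => ⟨c.eq_of_or h hκ, c.isQWeight h hμ₁ hμ₂ hω,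
      c.hasRangeRank_one h hω hκ⟩⟩
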